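/- Let $d\ge 1$ be an integer. For a prime power $q$ let $\mathcal F(2,d)$ be the set of $2$-step flags $F=(0=F_0\subseteq F_1\subseteq F_2=\mathbb F_q^d)$, and let $\mathcal{MU}_q(2,d)$ be the $\mathbb C$-algebra of $GL_d(\mathbb F_q)$-invariant functions $\mathcal F(2,d)\times\mathcal F(2,d)\times\mathbb F_q^d\to\mathbb C$ with the convolution product $$(\alpha*\beta)(F,F',w)=\sum_{H\in\mathcal F(2,d),\ u\in\mathbb F_q^d}\alpha(F,H,u)\,\beta(H,F',w-u).$$ Let $\Xi_{2,d}$ be the set of pairs $(A,\Delta)$, where $A=(a_{ij})$ is a $2\times2$ matrix of nonnegative integers with sum of entries $d$, and $\Delta=\{(i_1,j_1),\dots,(i_m,j_m)\}$ is a (possibly empty) set of positions with $i_1<\dots<i_m$, $j_m<\dots<j_1$ and $a_{ij}>0$ for $(i,j)\in\Delta$. For $(A,\Delta)\in\Xi_{2,d}$ let $\mathcal O_{A,\Delta}$ be the $GL_d(\mathbb F_q)$-orbit of the triples $(F,F',w)$ for which there is a basis $\{e_{ijk} : 1\le i,j\le 2,\ 1\le k\le a_{ij}\}$ of $\mathbb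 F_q^d$ with $F_r=\langle e_{ijk} : i\le r\rangle$, $F'_s=\langle e_{ijk} : j\le s\rangle$ and $w=\sum_{(i,j)\in\Delta}e_{ij1}$, and let $T_{A,\Delta}$ be the characteristic function of $\mathcal O_{A,\Delta}$. The $T_{A,\Delta}$ form a basis of $\mathcal{MU}_q(2,d)$ whose structure constants are polynomials in $q$; let $\mathcal{MU}_{\mathbf q}(2,d)$ be the corresponding $\mathbb C[\mathbf q,\mathbf q^{-1}]$-algebra with basis $T_{A,\Delta}$, whose specialization at $\mathbf q\mapsto q$ is $\mathcal{MU}_q(2,d)$ for every prime power $q$ (equivalently, the $\mathbb C[\mathbf q,\mathbf q^{-1}]$-subalgebra of $\prod_q\mathcal{MU}_q(2,d)$, with $\mathbf q$ acting on the factor $\mathcal{MU}_q(2,d)$ as the number $q$, generated by the families $(T_{A,\Delta})_q$). The generic mirabolic quantum Schur algebra is $$MU_{\mathbf v}(2,d)=\mathbb C(\mathbf v)\otimes_{\mathbb C[\mathbf q,\mathbf q^{-1}]}\mathcal{MU}_{\mathbf q}(2,d),\qquad \mathbf q\mapsto\mathbf v^2 .$$ In $MU_{\mathbf v}(2,d)$,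 writing $T_{A,\Delta}$ for $1\otimes T_{A,\Delta}$, put $$e_r=T_{\left(\begin{smallmatrix} r&1\\0&d-r-1\end{smallmatrix}\right),\emptyset},\quad f_r=T_{\left(\begin{smallmatrix} r&0\\1&d-r-1\end{smallmatrix}\right),\emptyset}\quad(0\le r\le d-1),$$ $$1_r=T_{\left(\begin{smallmatrix} r&0\\0&d-r\end{smallmatrix}\right),\emptyset}\quad(0\le r\le d),\qquad x_r=T_{\left(\begin{smallmatrix} r&0\\0&d-r\end{smallmatrix}\right),\{(1,1)\}}\quad(1\le r\le d).$$ **Theorem.** The elements $$e=\sum_{r=0}^{d-1}\mathbf v^{-r}e_r,\qquad f=\sum_{r=0}^{d-1}\mathbf v^{1+r-d}f_r,\qquad k=\sum_{r=0}^{d}\mathbf v^{2r-d}1_r,\qquad k^{-1}=\sum_{r=0}^{d}\mathbf v^{d-2r}1_r,$$ $$\ell=1_0+\sum_{r=1}^{d}\mathbf v^{-2r}(1_r+x_r)$$ generate the $\mathbb C(\mathbf v)$-algebra $MU_{\mathbf v}(2,d)$. -/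

import Mathlib

open scoped LaurentPolynomial TensorProduct

noncomputable section

namespace Mirabolic

/-! ### Partial flags over a finite field -/

/-- The set of `n`-step partial flags `0 = F_0 ⊆ F_1 ⊆ ⋯ ⊆ F_n = K^d`. -/
@[ext]
structure Flag (K : Type) [Field K] (n d : ℕ) where
  /-- the members of the flag -/
  sub : Fin (n + 1) → Submodule K (Fin d → K)
  mono : Monotone sub
  bot : sub 0 = ⊥
  top : sub (Fin.last n) = ⊤

section FiniteField

variable (K : Type) [Field K] [Fintype K] (n d : ℕ)

instance flagFinite : Finite (Flag K n d) := by
  have h1 : Finite (Submodule K (Fin d → K)) :=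
    Finite.of_injective (fun S : Submodule K (Fin d → K) => (S : Set (Fin d → K)))
      SetLike.coe_injective
  exact Finite.of_injective (fun F : Flag K n d => F.sub) (fun F G h => Flag.ext h)

instance flagFintype : Fintype (Flag K n d) := Fintype.ofFinite _

/-- The action of `g ∈ GL_d(K)` on flags: `F_i ↦ g(F_i)`. -/
def Flag.act {K : Type} [Field K] {n d : ℕ} (g : (Fin d → K) ≃ₗ[K] (Fin d → K))
    (F : Flag K n d) : Flag K n d where
  sub i := (F.sub i).map (g : (Fin d → K) →ₗ[K] (Fin d → K))
  mono := fun _ _ h => Submodule.map_mono (F.mono h)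
  bot := by rw [F.bot, Submodule.map_bot]
  top := by rw [F.top, Submodule.map_top, LinearEquiv.range]

theorem Flag.act_symm_act {K : Type} [Field K] {n d : ℕ}
    (g : (Fin d → K) ≃ₗ[K] (Fin d → K)) (F : Flag K n d) : (F.act g).act g.symm = F := by
  ext i x
  simp [Flag.act]

theorem Flag.act_act_symm {K : Type} [Field K] {n d : ℕ}
    (g : (Fin d → K) ≃ₗ[K] (Fin d → K)) (F : Flag K n d) : (F.act g.symm).act g = F := by
  simpa using Flag.act_symm_act g.symm F

/-- The action of `g ∈ GL_d(K)` on flags, as a permutation. -/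
def Flag.actEquiv {K : Type} [Field K] {n d : ℕ} (g : (Fin d → K) ≃ₗ[K] (Fin d → K)) :
    Flag K n d ≃ Flag K n d where
  toFun F := F.act g
  invFun F := F.act g.symm
  left_inv := Flag.act_symm_act g
  right_inv := Flag.act_act_symm g

/-! ### The convolution algebra of functions on pairs of flags together with a vector -/

/-- All complex functions `α(F, F', v)` on triples of two `n`-step flags and a vector of `K^d`. -/
def MirFun : Type := Flag K n d → Flag K n d → (Fin d → K) → ℂ

namespace MirFun

instance : AddCommGroup (MirFun K n d) :=
  inferInstanceAs (AddCommGroup (Flag K n d → Flag K n d → (Fin d → K) → ℂ))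

instance : Module ℂ (MirFun K n d) :=
  inferInstanceAs (Module ℂ (Flag K n d → Flag K n d → (Fin d → K) → ℂ))

/-- Convolution: `(α * β)(F, F', v) = ∑_{H, u} α(F, H, u) β(H, F', v - u)`. -/
instance : Mul (MirFun K n d) :=
  ⟨fun α β F F' v => ∑ H : Flag K n d, ∑ u : Fin d → K, α F H u * β H F' (v - u)⟩

open scoped Classical in
/-- The unit: the characteristic function of the set of triples `(F, F, 0)`. -/
instance : One (MirFun K n d) := ⟨fun F F' v => if F = F' ∧ v = 0 then 1 else 0⟩

variable {K n d}

theorem mul_apply (α β : MirFun K n d) (F F' : Flag K n d) (v : Fin d → K) :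
    (α * β) F F' v = ∑ H : Flag K n d, ∑ u : Fin d → K, α F H u * β H F' (v - u) := rfl

open scoped Classical in
theorem one_apply (F F' : Flag K n d) (v : Fin d → K) :
    (1 : MirFun K n d) F F' v = if F = F' ∧ v = 0 then 1 else 0 := rfl

theorem add_apply (α β : MirFun K n d) (F F' : Flag K n d) (v : Fin d → K) :
    (α + β) F F' v = α F F' v + β F F' v := rfl

theorem zero_apply (F F' : Flag K n d) (v : Fin d → K) : (0 : MirFun K n d) F F' v = 0 := rfl

theorem smul_apply (c : ℂ) (α : MirFun K n d) (F F' : Flag K n d) (v : Fin d → K) :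
    (c • α) F F' v = c * α F F' v := rfl

@[ext]
theorem ext' {α β : MirFun K n d} (h : ∀ F F' v, α F F' v = β F F' v) : α = β :=
  funext fun F => funext fun F' => funext fun v => h F F' v

theorem mul_assoc' (α β γ : MirFun K n d) : α * β * γ = α * (β * γ) := by
  ext F F' v
  simp only [mul_apply, Finset.sum_mul, Finset.mul_sum]
  calc ∑ H : Flag K n d, ∑ u : Fin d → K, ∑ H' : Flag K n d, ∑ u' : Fin d → K,
        α F H' u' * β H' H (u - u') * γ H F' (v - u)
      = ∑ H' : Flag K n d, ∑ u' : Fin d → K, ∑ H : Flag K n d, ∑ u : Fin d → K,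
        α F H' u' * β H' H (u - u') * γ H F' (v - u) := by
        rw [Finset.sum_congr rfl fun H _ => Finset.sum_comm, Finset.sum_comm]
        refine Finset.sum_congr rfl fun H' _ => ?_
        rw [Finset.sum_congr rfl fun H _ => Finset.sum_comm, Finset.sum_comm]
    _ = _ := by
        refine Finset.sum_congr rfl fun H' _ => Finset.sum_congr rfl fun u' _ =>
          Finset.sum_congr rfl fun H _ => ?_
        refine Fintype.sum_equiv (Equiv.subRight u') _ _ fun u => ?_
        simp [mul_assoc]

theorem one_mul' (α : MirFun K n d) : 1 * α = α := by
  classical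
  ext F F' v
  rw [mul_apply, Finset.sum_eq_single F, Finset.sum_eq_single 0]
  · simp [one_apply]
  · intro u _ hu; simp [one_apply, hu]
  · simp
  · intro H _ hH; simp [one_apply, hH.symm]
  · simp

theorem mul_one' (α : MirFun K n d) : α * 1 = α := by
  classical
  ext F F' v
  rw [mul_apply, Finset.sum_eq_single F', Finset.sum_eq_single v]
  · simp [one_apply]
  · intro u _ hu; simp [one_apply, sub_eq_zero, hu.symm]
  · simp
  · intro H _ hH; simp [one_apply, hH]
  · simp

instance : Ring (MirFun K n d) :=
  { (inferInstance : AddCommGroup (MirFun K n d)),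
    (inferInstance : Mul (MirFun K n d)),
    (inferInstance : One (MirFun K n d)) with
    mul_assoc := mul_assoc'
    one_mul := one_mul'
    mul_one := mul_one'
    zero_mul := fun α => by ext; simp [mul_apply, zero_apply]
    mul_zero := fun α => by ext; simp [mul_apply, zero_apply]
    left_distrib := fun α β γ => by
      ext; simp [mul_apply, add_apply, mul_add, Finset.sum_add_distrib]
    right_distrib := fun α β γ => by
      ext; simp [mul_apply, add_apply, add_mul, Finset.sum_add_distrib] }

instance : Algebra ℂ (MirFun K n d) :=
  Algebra.ofModule
    (fun c α β => by ext; simp [mul_apply, smul_apply, Finset.mul_sum, mul_assoc])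
    (fun c α β => by ext; simp [mul_apply, smul_apply, Finset.mul_sum, mul_left_comm])

end MirFun

/-- The subalgebra of `GL_d(K)`-invariant functions. -/
def invariants : Subalgebra ℂ (MirFun K n d) where
  carrier := {α | ∀ (g : (Fin d → K) ≃ₗ[K] (Fin d → K)) (F F' : Flag K n d) (v : Fin d → K),
    α (F.act g) (F'.act g) (g v) = α F F' v}
  mul_mem' := by
    intro α β hα hβ g F F' v
    rw [MirFun.mul_apply, MirFun.mul_apply]
    symm
    refine Fintype.sum_equiv (Flag.actEquiv g) _ _ fun H => ?_
    refine Fintype.sum_equiv g.toEquiv _ _ fun u => ?_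
    have h := hβ g H F' (v - u)
    rw [map_sub] at h
    exact (congrArg₂ (· * ·) (hα g F H u) h).symm
  add_mem' := by
    intro α β hα hβ g F F' v
    rw [MirFun.add_apply, MirFun.add_apply, hα, hβ]
  algebraMap_mem' := by
    intro c g F F' v
    rw [Algebra.algebraMap_eq_smul_one, MirFun.smul_apply, MirFun.smul_apply, MirFun.one_apply,
      MirFun.one_apply]
    have h : F.act g = F'.act g ↔ F = F' := (Flag.actEquiv g).injective.eq_iff
    have h2 : (F.act g = F'.act g ∧ g v = 0) ↔ (F = F' ∧ v = 0) := and_congr h (by simp)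
    by_cases h3 : F = F' ∧ v = 0
    · rw [if_pos h3, if_pos (h2.mpr h3)]
    · rw [if_neg h3, if_neg fun h4 => h3 (h2.mp h4)]

/-- The mirabolic quantum Schur algebra `𝓜𝓤_q(n, d)` over a finite field `K` with `q` elements:
the `GL_d(K)`-invariant functions, under convolution. -/
def MUq : Type := invariants K n d

instance : Ring (MUq K n d) := inferInstanceAs (Ring (invariants K n d))

instance : Algebra ℂ (MUq K n d) := inferInstanceAs (Algebra ℂ (invariants K n d))

end FiniteField

/-! ### Decorated matrices, orbits and their characteristic functions -/

/-- `(A, Δ) ∈ Ξ_{n,d}`: the entries of `A` sum to `d`, the positions in `Δ` form a set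
`{(i_1,j_1), …, (i_k,j_k)}` with `i_1 < ⋯ < i_k` and `j_k < ⋯ < j_1`, and `a_{ij} > 0` for
`(i,j) ∈ Δ`. Rows and columns are numbered from `0`. -/
def IsDecorated {n : ℕ} (d : ℕ) (A : Matrix (Fin n) (Fin n) ℕ) (Δ : Finset (Fin n × Fin n)) :
    Prop :=
  (∑ i, ∑ j, A i j = d) ∧
  (∀ x ∈ Δ, ∀ y ∈ Δ, x ≠ y → (x.1 < y.1 ∧ y.2 < x.2) ∨ (y.1 < x.1 ∧ x.2 < y.2)) ∧
  (∀ x ∈ Δ, 0 < A x.1 x.2)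

/-- The triple `(F, F', v)` lies in the orbit `𝓞_{A,Δ}`: there is a basis `e_{ijk}`
(`0 ≤ k < a_{ij}`) of `K^d` such that `F_r` is spanned by the `e_{ijk}` with `i` among the first
`r` row indices, `F'_s` by those with `j` among the first `s` column indices, and
`v` is the sum over `(i,j) ∈ Δ` of the first vector `e_{ij0}`. -/
def InOrbit {K : Type} [Field K] {n d : ℕ} (A : Matrix (Fin n) (Fin n) ℕ)
    (Δ : Finset (Fin n × Fin n)) (F F' : Flag K n d) (v : Fin d → K) : Prop :=
  ∃ b : Module.Basis (Σ p : Fin n × Fin n, Fin (A p.1 p.2)) K (Fin d → K),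
    (∀ r : Fin (n + 1), F.sub r = Submodule.span K (b '' {x | (x.1.1 : ℕ) < r})) ∧
    (∀ s : Fin (n + 1), F'.sub s = Submodule.span K (b '' {x | (x.1.2 : ℕ) < s})) ∧
    v = ∑ x, if x.1 ∈ Δ ∧ (x.2 : ℕ) = 0 then b x else 0

theorem InOrbit.act {K : Type} [Field K] {n d : ℕ} {A : Matrix (Fin n) (Fin n) ℕ}
    {Δ : Finset (Fin n × Fin n)} {F F' : Flag K n d} {v : Fin d → K}
    (g : (Fin d → K) ≃ₗ[K] (Fin d → K)) (h : InOrbit A Δ F F' v) :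
    InOrbit A Δ (F.act g) (F'.act g) (g v) := by
  obtain ⟨b, h1, h2, h3⟩ := h
  refine ⟨b.map g, fun r => ?_, fun s => ?_, ?_⟩
  · simp only [Flag.act, h1, Submodule.map_span, ← Set.image_comp]
    congr 1
  · simp only [Flag.act, h2, Submodule.map_span, ← Set.image_comp]
    congr 1
  · rw [h3, map_sum]
    refine Finset.sum_congr rfl fun x _ => ?_
    split_ifs <;> simp

open scoped Classical in
/-- The characteristic function `T_{A,Δ}` of the orbit `𝓞_{A,Δ}`, as an element of
`𝓜𝓤_q(n, d)`. -/
def Tq (K : Type) [Field K] [Fintype K] {n : ℕ} (d : ℕ) (A : Matrix (Fin n) (Fin n) ℕ)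
    (Δ : Finset (Fin n × Fin n)) : MUq K n d :=
  ⟨fun F F' v => if InOrbit A Δ F F' v then 1 else 0, by
    intro g F F' v
    have h : InOrbit A Δ (F.act g) (F'.act g) (g v) ↔ InOrbit A Δ F F' v := by
      refine ⟨fun h => ?_, InOrbit.act g⟩
      simpa [Flag.act_symm_act] using h.act g.symm
    simp only [h]⟩

/-! ### The generic mirabolic quantum Schur algebra -/

/-- Specialization `𝐪 ↦ q` of Laurent polynomials, where `q` is the cardinality of `K`. -/
def specialize (K : Type) [Field K] [Fintype K] : ℂ[T;T⁻¹] →+* ℂ :=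
  LaurentPolynomial.eval₂ (RingHom.id ℂ)
    (Units.mk0 (Fintype.card K : ℂ) (Nat.cast_ne_zero.mpr Fintype.card_ne_zero))

/-- `𝓜𝓤_q(n, d)` as an algebra over `ℂ[𝐪, 𝐪⁻¹]`, where `𝐪` acts by the number `q`. -/
instance (K : Type) [Field K] [Fintype K] (n d : ℕ) : Algebra ℂ[T;T⁻¹] (MUq K n d) :=
  Algebra.compHom (MUq K n d) (specialize K)

instance (p : Nat.Primes) : Fact (p : ℕ).Prime := ⟨p.2⟩

/-- The finite fields `𝔽_q`, indexed by `q = p ^ m` with `p` prime and `m ≥ 1`. -/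
abbrev Fq (q : Nat.Primes × ℕ+) : Type := GaloisField (q.1 : ℕ) (q.2 : ℕ)

instance (q : Nat.Primes × ℕ+) : Fintype (Fq q) := Fintype.ofFinite _

/-- The element `T_{A,Δ}` for all prime powers `q` at once. -/
def Tfamily {n : ℕ} (d : ℕ) (A : Matrix (Fin n) (Fin n) ℕ) (Δ : Finset (Fin n × Fin n)) :
    ∀ q : Nat.Primes × ℕ+, MUq (Fq q) n d :=
  fun q => Tq (Fq q) d A Δ

/-- The `ℂ[𝐪, 𝐪⁻¹]`-algebra `𝓜𝓤_𝐪(n, d)` with basis `T_{A,Δ}`, `(A, Δ) ∈ Ξ_{n,d}`, whose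
specialization at `𝐪 ↦ q` is `𝓜𝓤_q(n, d)` for every prime power `q`. It is realized inside the
product of the algebras `𝓜𝓤_q(n, d)` over all prime powers `q`, as the `ℂ[𝐪, 𝐪⁻¹]`-subalgebra
generated by the families `T_{A,Δ} = (T_{A,Δ})_q`. As the structure constants of the
`𝓜𝓤_q(n, d)` in the bases `T_{A,Δ}` are polynomials in `q`, this subalgebra is the
`ℂ[𝐪, 𝐪⁻¹]`-span of the `T_{A,Δ}`; these are linearly independent over `ℂ[𝐪, 𝐪⁻¹]`, because they
are so for every `q` and a Laurent polynomial that vanishes at all prime powers is zero. -/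
def genericSubalgebra (n d : ℕ) :
    Subalgebra ℂ[T;T⁻¹] (∀ q : Nat.Primes × ℕ+, MUq (Fq q) n d) :=
  Algebra.adjoin ℂ[T;T⁻¹]
    {t | ∃ (A : Matrix (Fin n) (Fin n) ℕ) (Δ : Finset (Fin n × Fin n)),
      IsDecorated d A Δ ∧ t = Tfamily d A Δ}

/-- The indeterminate of `ℂ(𝐯)`. -/
def v : RatFunc ℂ := RatFunc.X

/-- `ℂ(𝐯)` as an algebra over `ℂ[𝐪, 𝐪⁻¹]`, through `𝐪 ↦ 𝐯²`. -/
instance : Algebra ℂ[T;T⁻¹] (RatFunc ℂ) :=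
  RingHom.toAlgebra (LaurentPolynomial.eval₂ (algebraMap ℂ (RatFunc ℂ))
    (Units.mk0 (v ^ 2) (pow_ne_zero 2 RatFunc.X_ne_zero)))

/-- The generic mirabolic quantum Schur algebra
`MU_𝐯(n, d) = ℂ(𝐯) ⊗_{ℂ[𝐪, 𝐪⁻¹]} 𝓜𝓤_𝐪(n, d)`. -/
abbrev MUv (n d : ℕ) : Type := RatFunc ℂ ⊗[ℂ[T;T⁻¹]] genericSubalgebra n d

open scoped Classical in
/-- The element `T_{A,Δ}` of `MU_𝐯(n, d)`, interpreted as zero for `(A, Δ) ∉ Ξ_{n,d}`. -/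
def T {n : ℕ} (d : ℕ) (A : Matrix (Fin n) (Fin n) ℕ) (Δ : Finset (Fin n × Fin n)) : MUv n d :=
  if h : IsDecorated d A Δ then
    (1 : RatFunc ℂ) ⊗ₜ[ℂ[T;T⁻¹]]
      (⟨Tfamily d A Δ, Algebra.subset_adjoin ⟨A, Δ, h, rfl⟩⟩ : genericSubalgebra n d)
  else 0

/-! ### The Chevalley generators of `MU_𝐯(2, d)` -/

/-- `e_r = T_{D(r,d-r-1)+E_{1,2},∅}`, for `0 ≤ r ≤ d - 1`. -/
def eElt (d r : ℕ) : MUv 2 d := T d !![r, 1; 0, d - r - 1] ∅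

/-- `f_r = T_{D(r,d-r-1)+E_{2,1},∅}`, for `0 ≤ r ≤ d - 1`. -/
def fElt (d r : ℕ) : MUv 2 d := T d !![r, 0; 1, d - r - 1] ∅

/-- `1_r = T_{D(r,d-r),∅}`, for `0 ≤ r ≤ d`. -/
def oneElt (d r : ℕ) : MUv 2 d := T d !![r, 0; 0, d - r] ∅

/-- `x_r = T_{D(r,d-r),{(1,1)}}`, for `1 ≤ r ≤ d`. -/
def xElt (d r : ℕ) : MUv 2 d := T d !![r, 0; 0, d - r] {(0, 0)}

/-- `e = ∑_{r=0}^{d-1} 𝐯^{-r} e_r`. -/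
def e (d : ℕ) : MUv 2 d := ∑ r ∈ Finset.range d, v ^ (-(r : ℤ)) • eElt d r

/-- `f = ∑_{r=0}^{d-1} 𝐯^{1+r-d} f_r`. -/
def f (d : ℕ) : MUv 2 d := ∑ r ∈ Finset.range d, v ^ (1 + (r : ℤ) - (d : ℤ)) • fElt d r

/-- `k = ∑_{r=0}^{d} 𝐯^{2r-d} 1_r`. -/
def k (d : ℕ) : MUv 2 d := ∑ r ∈ Finset.range (d + 1), v ^ (2 * (r : ℤ) - (d : ℤ)) • oneElt d r

/-- `k⁻¹ = ∑_{r=0}^{d} 𝐯^{d-2r} 1_r`. -/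
def kInv (d : ℕ) : MUv 2 d :=
  ∑ r ∈ Finset.range (d + 1), v ^ ((d : ℤ) - 2 * (r : ℤ)) • oneElt d r

/-- `ℓ = 1_0 + ∑_{r=1}^{d} 𝐯^{-2r} (1_r + x_r)`. -/
def ell (d : ℕ) : MUv 2 d :=
  oneElt d 0 + ∑ r ∈ Finset.Icc 1 d, v ^ (-2 * (r : ℤ)) • (oneElt d r + xElt d r)

end Mirabolic

end

noncomputable section

namespace Mirabolic

open Module

/-! ### Counting hyperplanes -/

section Counting

variable {K E : Type*} [Field K] [Finite K] [AddCommGroup E] [Module K E] [FiniteDimensional K E]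

/-! A two-step flag is just its middle subspace, so a triple is `(F, G, w)` with `F`, `G` subspaces
of `K^d`. Its orbit is determined by `r = dim F`, `s = dim G`, `a = dim (F ∩ G)` and by whether `w`
is zero, lies in `F`, in `G`, in `F + G` (`inOrbit_iff`). So each `T_{A,Δ}` is a family of functions
`posFun`, and these have to be found in the subalgebra `S` generated by the given elements.

The `1_r` are orthogonal idempotents with sum `1`, and `k` acts on them by pairwise distinct
scalars. Hence they are polynomials in `k` (`eigenprojection_mem`), and cutting `e`, `f`, `ℓ` by
them gives all `e_r`, `f_r`, `x_r` (`containsChevalley`).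

Left multiplication by `e_r` sums over the hyperplanes `H` of `F`. For functions supported on `w =
0`, or on nonzero `w ∈ F ∩ G`, counting hyperplanes gives `(q - 1) e_r * T(r,s,a) = (q^(r+1-a) - 1)
T(r+1,s,a) + c T(r+1,s,a+1)`, and right multiplication by `f_s` behaves in the same way
(`zeroFun_mul_infFun`, `infFun_mul_zeroFun`). Induction on `r + s - 2a` then produces all these
functions from the diagonal ones `1_r`, `x_r` (`gen_infFun`).

The conditions `w ∈ F` and `w ∈ G` come from products with diagonal functions, and `w ∈ F + G` from
the product of two such functions (`left_mul_right`). A vector outside `F` is reached through the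
larger space `F + ⟨w⟩` (`posFun_diff_mul_zeroFun`). Differences of these indicators give the six
possible `Δ` (`gen_markedAt`).

All identities are checked on functions for every `q` and carried to the generic algebra by
`toFam_injective`. Division by `q^m - 1` takes place in `S`, where scalars from `ℂ(𝐯)` are available
(`Gen.of_smul`); linear independence of the `T_{A,Δ}` plays no role. -/

theorem card_mem_ne_zero (W : Submodule K E) :
    Nat.card {x : E // x ∈ W ∧ x ≠ 0} = Nat.card K ^ finrank K W - 1 := by
  have : Finite E := Module.finite_of_finite K
  have h : {x : E // x ∈ W ∧ x ≠ 0} ≃ {x : W // x ≠ 0} :=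
    { toFun := fun x => ⟨⟨x.1, x.2.1⟩, fun h => x.2.2 (congrArg Subtype.val h)⟩
      invFun := fun x => ⟨x.1.1, x.1.2, fun h => x.2 (Subtype.ext h)⟩
      left_inv := fun _ => rfl
      right_inv := fun _ => rfl }
  rw [Nat.card_congr h, ← Module.natCard_eq_pow_finrank (K := K) (V := W)]
  have := Fintype.ofFinite W
  classical
  rw [Nat.card_eq_fintype_card, Nat.card_eq_fintype_card, Fintype.card_subtype_compl,
    Fintype.card_subtype_eq]

omit [Finite K] in
theorem ker_eq_of_mem_dualAnnihilator {H : Submodule K E} (hH : finrank K H + 1 = finrank K E)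
    {φ : Dual K E} (hφ : φ ∈ H.dualAnnihilator) (h0 : φ ≠ 0) : LinearMap.ker φ = H := by
  have h1 := Module.Dual.finrank_ker_add_one_of_ne_zero h0
  refine (Submodule.eq_of_le_of_finrank_eq (fun x hx => ?_) (by omega)).symm
  exact (Submodule.mem_dualAnnihilator φ).mp hφ x hx

/-- A hyperplane containing `U` is the kernel of a nonzero functional that vanishes on `U`, and that
functional is unique up to one of `q - 1` nonzero scalars. -/
theorem sub_one_mul_card_hyperplanes (U : Submodule K E) :
    (Nat.card K - 1) * Nat.card {H : Submodule K E // U ≤ H ∧ finrank K H + 1 = finrank K E} =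
      Nat.card K ^ (finrank K E - finrank K U) - 1 := by
  classical
  have : Finite E := Module.finite_of_finite K
  have : Finite (Dual K E) := Module.finite_of_finite K
  have : Finite (Submodule K E) :=
    Finite.of_injective (fun S : Submodule K E => (S : Set E)) SetLike.coe_injective
  have hU := Subspace.finrank_add_finrank_dualAnnihilator_eq U
  rw [← show finrank K U.dualAnnihilator = finrank K E - finrank K U by omega,
    ← card_mem_ne_zero]
  let f : {φ : Dual K E // φ ∈ U.dualAnnihilator ∧ φ ≠ 0} →
      {H : Submodule K E // U ≤ H ∧ finrank K H + 1 = finrank K E} := fun φ =>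
    ⟨LinearMap.ker φ.1, fun x hx => (Submodule.mem_dualAnnihilator φ.1).mp φ.2.1 x hx,
      Module.Dual.finrank_ker_add_one_of_ne_zero φ.2.2⟩
  -- The fibre over `H` consists of the nonzero elements of the line of functionals vanishing on
  -- `H`.
  have hf : ∀ H, Nat.card {φ // f φ = H} = Nat.card K - 1 := by
    intro H
    have hH := Subspace.finrank_add_finrank_dualAnnihilator_eq H.1
    have h1 : finrank K H.1.dualAnnihilator = 1 := by have := H.2.2; omega
    have h3 := card_mem_ne_zero (K := K) H.1.dualAnnihilator
    rw [h1, pow_one] at h3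
    rw [← h3]
    refine Nat.card_congr
      { toFun := fun φ => ⟨φ.1.1, ?_, φ.1.2.2⟩
        invFun := fun φ => ⟨⟨φ.1, ?_, φ.2.2⟩, ?_⟩
        left_inv := fun _ => rfl
        right_inv := fun _ => rfl }
    · have h2 : LinearMap.ker φ.1.1 = H.1 := congrArg Subtype.val φ.2
      rw [Submodule.mem_dualAnnihilator]
      intro x hx
      rw [← h2] at hx
      exact hx
    · exact Submodule.dualAnnihilator_anti H.2.1 φ.2.1
    · exact Subtype.ext (ker_eq_of_mem_dualAnnihilator H.2.2 φ.2.1 φ.2.2)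
  have := Fintype.ofFinite {H : Submodule K E // U ≤ H ∧ finrank K H + 1 = finrank K E}
  rw [← Nat.card_congr (Equiv.sigmaFiberEquiv f), Nat.card_sigma, Finset.sum_congr rfl
    fun H _ => hf H, Finset.sum_const, smul_eq_mul, Finset.card_univ, mul_comm,
    Nat.card_eq_fintype_card (α := {H : Submodule K E // U ≤ H ∧ finrank K H + 1 = finrank K E})]

theorem sub_one_mul_card_hyperplanes_of_le {U F : Submodule K E} (hUF : U ≤ F) :
    (Nat.card K - 1) *
        Nat.card {H : Submodule K E // H ≤ F ∧ finrank K H + 1 = finrank K F ∧ U ≤ H} =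
      Nat.card K ^ (finrank K F - finrank K U) - 1 := by
  have h := sub_one_mul_card_hyperplanes (U.comap F.subtype)
  have hU : finrank K (U.comap F.subtype) = finrank K U :=
    (Submodule.comapSubtypeEquivOfLe hUF).finrank_eq
  rw [hU] at h
  rw [← h]
  congr 1
  refine Nat.card_congr
    { toFun := fun H => ⟨H.1.comap F.subtype, Submodule.comap_mono H.2.2.2, ?_⟩
      invFun := fun H => ⟨H.1.map F.subtype, Submodule.map_subtype_le _ _, ?_, ?_⟩
      left_inv := fun H => Subtype.ext ?_
      right_inv := fun H => Subtype.ext ?_ }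
  · rw [(Submodule.comapSubtypeEquivOfLe H.2.1).finrank_eq, H.2.2.1]
  · rw [Submodule.finrank_map_subtype_eq, H.2.2]
  · have := Submodule.map_mono (f := F.subtype) H.2.1
    rwa [Submodule.map_comap_subtype, inf_eq_right.mpr hUF] at this
  · simp only [Submodule.map_comap_subtype, inf_eq_right.mpr H.2.1]
  · exact Submodule.comap_map_eq_of_injective F.injective_subtype _

/-- The number of hyperplanes of `F` that contain `U` but not `W`. -/
theorem sub_one_mul_card_hyperplanes_not_le {U W F : Submodule K E} (hUW : U ≤ W) (hWF : W ≤ F) :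
    ((Nat.card K : ℂ) - 1) * (Nat.card
        {H : Submodule K E // H ≤ F ∧ finrank K H + 1 = finrank K F ∧ U ≤ H ∧ ¬ W ≤ H} : ℂ) =
      (Nat.card K : ℂ) ^ (finrank K F - finrank K U) -
        (Nat.card K : ℂ) ^ (finrank K F - finrank K W) := by
  classical
  have : Finite E := Module.finite_of_finite K
  have : Finite (Submodule K E) :=
    Finite.of_injective (fun S : Submodule K E => (S : Set E)) SetLike.coe_injective
  have := Fintype.ofFinite (Submodule K E)
  have hq : 1 ≤ Nat.card K := Nat.card_pos
  have h1 := sub_one_mul_card_hyperplanes_of_le (hUW.trans hWF)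
  have h2 := sub_one_mul_card_hyperplanes_of_le hWF
  have h3 : Nat.card {H : Submodule K E // H ≤ F ∧ finrank K H + 1 = finrank K F ∧ U ≤ H} =
      Nat.card {H : Submodule K E // H ≤ F ∧ finrank K H + 1 = finrank K F ∧ W ≤ H} +
      Nat.card
        {H : Submodule K E // H ≤ F ∧ finrank K H + 1 = finrank K F ∧ U ≤ H ∧ ¬ W ≤ H} := by
    simp only [Nat.card_eq_fintype_card, Fintype.card_subtype]
    rw [← Finset.card_union_of_disjoint]
    · congr 1
      ext H
      simp only [Finset.mem_filter, Finset.mem_univ, true_and, Finset.mem_union]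
      have : W ≤ H → U ≤ H := hUW.trans
      tauto
    · rw [Finset.disjoint_filter]
      tauto
  have e1 := congrArg (Nat.cast (R := ℂ)) h1
  have e2 := congrArg (Nat.cast (R := ℂ)) h2
  have e3 := congrArg (Nat.cast (R := ℂ)) h3
  rw [Nat.cast_mul, Nat.cast_sub hq, Nat.cast_sub (Nat.one_le_pow _ _ hq)] at e1 e2
  push_cast at e1 e2 e3
  rw [e3] at e1
  linear_combination e1 - e2

end Counting

/-! ### Bases adapted to a pair of subspaces and a vector -/

/-- One layer of an adapted basis, from `I` up to `F`: the first new vector may be prescribed as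
soon as it lies outside `I`. -/
theorem exists_family_sup_span {K V : Type*} [Field K] [AddCommGroup V] [Module K V]
    [FiniteDimensional K V] (n : ℕ) :
    ∀ (I F : Submodule K V) (_ : I ≤ F) (_ : finrank K F = finrank K I + n) (w : V) (_ : w ∈ F),
      ∃ b : Fin n → V, I ⊔ Submodule.span K (Set.range b) = F ∧
        (w ∉ I → ∀ h : 0 < n, b ⟨0, h⟩ = w) := by
  induction n with
  | zero =>
    intro I F hIF hd w hw
    refine ⟨Fin.elim0, ?_, fun _ h => absurd h (lt_irrefl 0)⟩
    have := Submodule.eq_of_le_of_finrank_eq hIF (by omega)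
    simp [Set.range_eq_empty, this]
  | succ n ih =>
    intro I F hIF hd w hw
    have hlt : I < F := lt_of_le_of_ne hIF fun h => by subst h; omega
    obtain ⟨x, hxF, hxI, hx⟩ : ∃ x ∈ F, x ∉ I ∧ (w ∉ I → x = w) := by
      by_cases h : w ∈ I
      · obtain ⟨x, hxF, hxI⟩ := SetLike.exists_of_lt hlt
        exact ⟨x, hxF, hxI, fun h' => absurd h h'⟩
      · exact ⟨w, hw, h, fun _ => rfl⟩
    have hle : I ⊔ Submodule.span K {x} ≤ F :=
      sup_le hIF ((Submodule.span_singleton_le_iff_mem _ _).mpr hxF)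
    have hd' : finrank K (I ⊔ Submodule.span K {x} : Submodule K V) = finrank K I + 1 :=
      Submodule.finrank_sup_span_singleton hxI
    obtain ⟨b, hb, -⟩ := ih (I ⊔ Submodule.span K {x}) F hle (by omega) w hw
    refine ⟨Fin.cons x b, ?_, fun h _ => hx h⟩
    rw [Fin.range_cons, Submodule.span_insert, ← sup_assoc, hb]

section Orbits

variable {K : Type} [Field K] {d : ℕ} {A : Matrix (Fin 2) (Fin 2) ℕ} {Δ : Finset (Fin 2 × Fin 2)}

theorem finrank_span_basis_image {V : Type*} [AddCommGroup V] [Module K V]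
    (b : Basis (Σ p : Fin 2 × Fin 2, Fin (A p.1 p.2)) K V) (Q : Fin 2 × Fin 2 → Prop)
    [DecidablePred Q] :
    finrank K (Submodule.span K (b '' {x | Q x.1})) =
      ∑ p : Fin 2 × Fin 2, if Q p then A p.1 p.2 else 0 := by
  have h : LinearIndependent K fun x : {x : Σ p : Fin 2 × Fin 2, Fin (A p.1 p.2) // Q x.1} => b x :=
    b.linearIndependent.comp _ Subtype.val_injective
  have h2 : b '' {x | Q x.1} =
      Set.range fun x : {x : Σ p : Fin 2 × Fin 2, Fin (A p.1 p.2) // Q x.1} => b x := by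
    ext y; simp
  rw [h2, finrank_span_eq_card h, Fintype.card_subtype, Finset.card_filter, Fintype.sum_sigma]
  refine Finset.sum_congr rfl fun p _ => ?_
  split_ifs with hp <;> simp

/-- The coordinates of the sum are `1` at the first vector of each marked position and `0`
elsewhere; positivity of the marked entries ensures that this first vector exists. -/
theorem marked_sum_mem_span_iff {V : Type*} [AddCommGroup V] [Module K V]
    (b : Basis (Σ p : Fin 2 × Fin 2, Fin (A p.1 p.2)) K V) (hA : ∀ p ∈ Δ, 0 < A p.1 p.2)
    (Q : Fin 2 × Fin 2 → Prop) :
    (∑ x, if x.1 ∈ Δ ∧ (x.2 : ℕ) = 0 then b x else 0) ∈ Submodule.span K (b '' {x | Q x.1}) ↔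
      ∀ p ∈ Δ, Q p := by
  classical
  have h : (∑ x, if x.1 ∈ Δ ∧ (x.2 : ℕ) = 0 then b x else 0) =
      ∑ x, (if x.1 ∈ Δ ∧ (x.2 : ℕ) = 0 then (1 : K) else 0) • b x :=
    Finset.sum_congr rfl fun x _ => by split_ifs <;> simp
  rw [h, Basis.mem_span_image]
  have h2 : ∀ x, b.repr (∑ x, (if x.1 ∈ Δ ∧ (x.2 : ℕ) = 0 then (1 : K) else 0) • b x) x =
      if x.1 ∈ Δ ∧ (x.2 : ℕ) = 0 then (1 : K) else 0 := fun x => by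
    rw [Basis.repr_sum_self]
  constructor
  · intro hs p hp
    have := @hs ⟨p, ⟨0, hA p hp⟩⟩
    simp only [Finset.mem_coe, Finsupp.mem_support_iff, h2, Set.mem_ofPred_eq] at this
    exact this (by simp [hp])
  · intro hQ x hx
    simp only [Finset.mem_coe, Finsupp.mem_support_iff, h2] at hx
    by_cases hc : x.1 ∈ Δ ∧ (x.2 : ℕ) = 0
    · exact hQ _ hc.1
    · simp [hc] at hx

/-- The basis is assembled from the four layers `0 ≤ F ∩ G`, `F ∩ G ≤ F`, `F ∩ G ≤ G` and `F + G ≤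
K^d`. It spans, and it has the right cardinality. The vectors `u p` are the desired marked ones,
used only where they are new in their layer. -/
theorem exists_adapted_basis (F G : Submodule K (Fin d → K)) (hd : ∑ i, ∑ j, A i j = d)
    (hF : finrank K F = A 0 0 + A 0 1) (hG : finrank K G = A 0 0 + A 1 0)
    (hI : finrank K (F ⊓ G : Submodule K (Fin d → K)) = A 0 0)
    (u : Fin 2 × Fin 2 → Fin d → K) (h00 : u (0, 0) ∈ F ⊓ G) (h01 : u (0, 1) ∈ F)
    (h10 : u (1, 0) ∈ G) :
    ∃ b : Basis (Σ p : Fin 2 × Fin 2, Fin (A p.1 p.2)) K (Fin d → K),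
      Submodule.span K (b '' {x | x.1.1 = 0}) = F ∧
      Submodule.span K (b '' {x | x.1.2 = 0}) = G ∧
      (u (0, 0) ≠ 0 → ∀ h, b ⟨(0, 0), ⟨0, h⟩⟩ = u (0, 0)) ∧
      (u (0, 1) ∉ F ⊓ G → ∀ h, b ⟨(0, 1), ⟨0, h⟩⟩ = u (0, 1)) ∧
      (u (1, 0) ∉ F ⊓ G → ∀ h, b ⟨(1, 0), ⟨0, h⟩⟩ = u (1, 0)) ∧
      (u (1, 1) ∉ F ⊔ G → ∀ h, b ⟨(1, 1), ⟨0, h⟩⟩ = u (1, 1)) := by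
  have hS := Submodule.finrank_sup_add_finrank_inf_eq F G
  simp only [Fin.sum_univ_two] at hd
  obtain ⟨b00, s00, e00⟩ := exists_family_sup_span (A 0 0) ⊥ (F ⊓ G) bot_le (by simp [hI]) _ h00
  obtain ⟨b01, s01, e01⟩ := exists_family_sup_span (A 0 1) (F ⊓ G) F inf_le_left
    (by omega) _ h01
  obtain ⟨b10, s10, e10⟩ := exists_family_sup_span (A 1 0) (F ⊓ G) G inf_le_right
    (by omega) _ h10
  obtain ⟨b11, s11, e11⟩ := exists_family_sup_span (A 1 1) (F ⊔ G) ⊤ le_top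
    (by rw [finrank_top, finrank_fin_fun]; omega) (u (1, 1)) trivial
  rw [bot_sup_eq] at s00
  let g : (Σ p : Fin 2 × Fin 2, Fin (A p.1 p.2)) → Fin d → K := fun x =>
    match x with
    | ⟨(0, 0), k⟩ => b00 k
    | ⟨(0, 1), k⟩ => b01 k
    | ⟨(1, 0), k⟩ => b10 k
    | ⟨(1, 1), k⟩ => b11 k
  have r0 : g '' {x | x.1.1 = 0} = Set.range b00 ∪ Set.range b01 := by
    ext y
    simp [g, Sigma.exists, Prod.exists, Fin.exists_fin_two]
  have r1 : g '' {x | x.1.2 = 0} = Set.range b00 ∪ Set.range b10 := by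
    ext y
    simp [g, Sigma.exists, Prod.exists, Fin.exists_fin_two]
  have rt : Set.range g = (Set.range b00 ∪ Set.range b01) ∪ (Set.range b10 ∪ Set.range b11) := by
    ext y
    simp [g, Sigma.exists, Prod.exists, Fin.exists_fin_two, or_assoc]
  have hF' : Submodule.span K (g '' {x | x.1.1 = 0}) = F := by
    rw [r0, Submodule.span_union, s00, s01]
  have hG' : Submodule.span K (g '' {x | x.1.2 = 0}) = G := by
    rw [r1, Submodule.span_union, s00, s10]
  have ht : ⊤ ≤ Submodule.span K (Set.range g) := by
    rw [← s11, sup_le_iff, sup_le_iff]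
    refine ⟨⟨?_, ?_⟩, ?_⟩
    · exact hF'.symm.le.trans (Submodule.span_mono (Set.image_subset_range _ _))
    · exact hG'.symm.le.trans (Submodule.span_mono (Set.image_subset_range _ _))
    · exact Submodule.span_mono (rt ▸ fun y hy => Or.inr (Or.inr hy))
  have hc : Fintype.card (Σ p : Fin 2 × Fin 2, Fin (A p.1 p.2)) = finrank K (Fin d → K) := by
    rw [finrank_fin_fun, Fintype.card_sigma, Fintype.sum_prod_type]
    simp [Fin.sum_univ_two, ← hd]
  refine ⟨basisOfTopLeSpanOfCardEqFinrank g ht hc, ?_⟩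
  rw [coe_basisOfTopLeSpanOfCardEqFinrank]
  exact ⟨hF', hG', fun h => e00 (by simpa using h), e01, e10, e11⟩

/-- The position of `w` relative to two subspaces prescribed by a set `Δ` of marked positions. -/
def MarkedAt (Δ : Finset (Fin 2 × Fin 2)) (F G : Submodule K (Fin d → K)) (w : Fin d → K) : Prop :=
  (w = 0 ↔ Δ = ∅) ∧ (w ∈ F ↔ ∀ p ∈ Δ, p.1 = 0) ∧ (w ∈ G ↔ ∀ p ∈ Δ, p.2 = 0) ∧
    (w ∈ F ⊔ G ↔ ∀ p ∈ Δ, p.1 = 0 ∨ p.2 = 0)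

theorem antichain_cases (Δ : Finset (Fin 2 × Fin 2))
    (h : ∀ x ∈ Δ, ∀ y ∈ Δ, x ≠ y → (x.1 < y.1 ∧ y.2 < x.2) ∨ (y.1 < x.1 ∧ x.2 < y.2)) :
    Δ = ∅ ∨ Δ = {(0, 0)} ∨ Δ = {(0, 1)} ∨ Δ = {(1, 0)} ∨ Δ = {(1, 1)} ∨
      Δ = {(0, 1), (1, 0)} := by
  simp only [Prod.forall, Fin.forall_fin_two] at h
  simp only [Finset.ext_iff, Prod.forall, Fin.forall_fin_two]
  by_cases h1 : (0, 0) ∈ Δ <;> by_cases h2 : (0, 1) ∈ Δ <;> by_cases h3 : (1, 0) ∈ Δ <;>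
    by_cases h4 : (1, 1) ∈ Δ <;> simp [h1, h2, h3, h4] at h ⊢

theorem val_lt_one_iff (i : Fin 2) : (i : ℕ) < ((1 : Fin 3) : ℕ) ↔ i = 0 := by
  revert i
  decide

theorem InOrbit.finrank_and_markedAt (hA : IsDecorated d A Δ) {F G : Flag K 2 d} {w : Fin d → K}
    (h : InOrbit A Δ F G w) :
    finrank K (F.sub 1) = A 0 0 + A 0 1 ∧ finrank K (G.sub 1) = A 0 0 + A 1 0 ∧
      finrank K (F.sub 1 ⊓ G.sub 1 : Submodule K (Fin d → K)) = A 0 0 ∧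
      MarkedAt Δ (F.sub 1) (G.sub 1) w := by
  obtain ⟨b, hF, hG, rfl⟩ := h
  have hp := hA.2.2
  have eF : F.sub 1 = Submodule.span K (b '' {x | x.1.1 = 0}) := by
    simp only [hF 1, val_lt_one_iff]
  have eG : G.sub 1 = Submodule.span K (b '' {x | x.1.2 = 0}) := by
    simp only [hG 1, val_lt_one_iff]
  have eS : F.sub 1 ⊔ G.sub 1 = Submodule.span K (b '' {x | x.1.1 = 0 ∨ x.1.2 = 0}) := by
    rw [eF, eG, ← Submodule.span_union, ← Set.image_union]; rfl
  have e0 : Submodule.span K (b '' {x | False}) = ⊥ := by simp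
  have dF : finrank K (F.sub 1) = A 0 0 + A 0 1 := by
    rw [eF, finrank_span_basis_image b fun p => p.1 = 0]
    simp [Fintype.sum_prod_type, Fin.sum_univ_two]
  have dG : finrank K (G.sub 1) = A 0 0 + A 1 0 := by
    rw [eG, finrank_span_basis_image b fun p => p.2 = 0]
    simp [Fintype.sum_prod_type, Fin.sum_univ_two]
  have dS : finrank K (F.sub 1 ⊔ G.sub 1 : Submodule K (Fin d → K)) =
      A 0 0 + A 0 1 + A 1 0 := by
    rw [eS, finrank_span_basis_image b fun p => p.1 = 0 ∨ p.2 = 0]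
    simp [Fintype.sum_prod_type, Fin.sum_univ_two]
  have hS := Submodule.finrank_sup_add_finrank_inf_eq (F.sub 1) (G.sub 1)
  refine ⟨dF, dG, by omega, ?_, ?_, ?_, ?_⟩
  · rw [← Submodule.mem_bot K, ← e0, marked_sum_mem_span_iff b hp fun _ => False,
      Finset.eq_empty_iff_forall_notMem]
  · rw [eF, marked_sum_mem_span_iff b hp fun p => p.1 = 0]
  · rw [eG, marked_sum_mem_span_iff b hp fun p => p.2 = 0]
  · rw [eS, marked_sum_mem_span_iff b hp fun p => p.1 = 0 ∨ p.2 = 0]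

theorem inOrbit_of_vectors (hA : IsDecorated d A Δ) {F G : Flag K 2 d}
    (hF : finrank K (F.sub 1) = A 0 0 + A 0 1) (hG : finrank K (G.sub 1) = A 0 0 + A 1 0)
    (hI : finrank K (F.sub 1 ⊓ G.sub 1 : Submodule K (Fin d → K)) = A 0 0)
    (u : Fin 2 × Fin 2 → Fin d → K)
    (h00 : u (0, 0) ∈ F.sub 1 ⊓ G.sub 1) (h01 : u (0, 1) ∈ F.sub 1) (h10 : u (1, 0) ∈ G.sub 1)
    (n00 : (0, 0) ∈ Δ → u (0, 0) ≠ 0) (n01 : (0, 1) ∈ Δ → u (0, 1) ∉ F.sub 1 ⊓ G.sub 1)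
    (n10 : (1, 0) ∈ Δ → u (1, 0) ∉ F.sub 1 ⊓ G.sub 1)
    (n11 : (1, 1) ∈ Δ → u (1, 1) ∉ F.sub 1 ⊔ G.sub 1) :
    InOrbit A Δ F G (∑ p ∈ Δ, u p) := by
  obtain ⟨b, sF, sG, e00, e01, e10, e11⟩ :=
    exists_adapted_basis (F.sub 1) (G.sub 1) hA.1 hF hG hI u h00 h01 h10
  have hb : ∀ p ∈ Δ, ∀ h, b ⟨p, ⟨0, h⟩⟩ = u p := by
    rintro ⟨i, j⟩ hp
    fin_cases i <;> fin_cases j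
    exacts [e00 (n00 hp), e01 (n01 hp), e10 (n10 hp), e11 (n11 hp)]
  refine ⟨b, fun r => ?_, fun s => ?_, ?_⟩
  · fin_cases r
    · simp [F.bot]
    · exact sF.symm.trans (by simp only [← val_lt_one_iff]; rfl)
    · exact F.top.trans (by rw [← b.span_eq, ← Set.image_univ]; congr 2; ext x; simp; omega)
  · fin_cases s
    · simp [G.bot]
    · exact sG.symm.trans (by simp only [← val_lt_one_iff]; rfl)
    · exact G.top.trans (by rw [← b.span_eq, ← Set.image_univ]; congr 2; ext x; simp; omega)
  · rw [Fintype.sum_sigma, ← Finset.sum_subset (Finset.subset_univ Δ)]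
    · refine Finset.sum_congr rfl fun p hp => ?_
      have hpos := hA.2.2 p hp
      rw [Finset.sum_eq_single ⟨0, hpos⟩]
      · simp [hp, hb p hp hpos]
      · intro k _ hk
        rw [if_neg]
        exact fun h => hk (Fin.ext h.2)
      · simp
    · intro p _ hp
      simp [hp]

/-- This replaces the search for a basis by dimensions and membership conditions; everything later
uses orbits only in this form. -/
theorem inOrbit_iff (hA : IsDecorated d A Δ) {F G : Flag K 2 d} {w : Fin d → K} :
    InOrbit A Δ F G w ↔
    finrank K (F.sub 1) = A 0 0 + A 0 1 ∧ finrank K (G.sub 1) = A 0 0 + A 1 0 ∧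
      finrank K (F.sub 1 ⊓ G.sub 1 : Submodule K (Fin d → K)) = A 0 0 ∧
      MarkedAt Δ (F.sub 1) (G.sub 1) w := by
  refine ⟨fun h => h.finrank_and_markedAt hA, ?_⟩
  rintro ⟨hF, hG, hI, h0, h1, h2, h3⟩
  have key := inOrbit_of_vectors hA hF hG hI
  rcases antichain_cases Δ hA.2.1 with rfl | rfl | rfl | rfl | rfl | rfl <;>
    simp at h0 h1 h2 h3
  · simpa [h0] using key (fun _ => 0)
  · simpa [h0, h1, h2] using key (Function.update 0 (0, 0) w)
  · simpa [h0, h1, h2] using key (Function.update 0 (0, 1) w)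
  · simpa [h0, h1, h2] using key (Function.update 0 (1, 0) w)
  · simpa [h0, h1, h2, h3] using key (Function.update 0 (1, 1) w)
  -- With two marks, `w ∈ F + G` lies in neither summand. Any splitting `w = x + y` then has `x ∉ G`
  -- and `y ∉ F`, so `x` and `y` can serve as the two marked basis vectors.
  · obtain ⟨x, hx, y, hy, rfl⟩ := Submodule.mem_sup.mp h3
    have hx' : x ∉ G.sub 1 := fun h => h2 (add_mem h hy)
    have hy' : y ∉ F.sub 1 := fun h => h1 (add_mem hx h)
    simpa [hx, hy, hx', hy'] using key (Function.update (Function.update 0 (0, 1) x) (1, 0) y)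

end Orbits

/-! ### Functions determined by relative position -/

section Convolution

variable (K : Type) [Field K] [Fintype K] (d : ℕ)

open scoped Classical in
/-- The characteristic function of the triples `(F, G, w)` such that `F_1`, `G_1`, `F_1 ∩ G_1` have
dimensions `r`, `s`, `a` and `w` lies in the set `X F_1 G_1`. -/
def posFun (r s a : ℕ)
    (X : Submodule K (Fin d → K) → Submodule K (Fin d → K) → Set (Fin d → K)) : MirFun K 2 d :=
  fun F G w => if finrank K (F.sub 1) = r ∧ finrank K (G.sub 1) = s ∧
    finrank K (F.sub 1 ⊓ G.sub 1 : Submodule K (Fin d → K)) = a ∧ w ∈ X (F.sub 1) (G.sub 1)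
    then 1 else 0

/-- `posFun` for vectors `w` in the intersection that satisfy `C`. -/
def infFun (C : (Fin d → K) → Prop) (r s a : ℕ) : MirFun K 2 d :=
  posFun K d r s a fun F G => {w | w ∈ F ⊓ G ∧ C w}

/-- `posFun` for the zero vector. -/
def zeroFun (r s a : ℕ) : MirFun K 2 d := posFun K d r s a fun _ _ => {0}

variable {K d}

/-- Two-step flags are subspaces. -/
def flagEquiv : Flag K 2 d ≃ Submodule K (Fin d → K) where
  toFun F := F.sub 1
  invFun S :=
    { sub := ![⊥, S, ⊤]
      mono := by
        intro i j h
        fin_cases i <;> fin_cases j <;> simp at h ⊢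
      bot := rfl
      top := rfl }
  left_inv F := by
    ext1
    funext i
    fin_cases i
    exacts [F.bot.symm, rfl, F.top.symm]
  right_inv _ := rfl

omit [Fintype K] in
theorem Flag.eq_of_sub_one_eq {F G : Flag K 2 d} (h : F.sub 1 = G.sub 1) : F = G :=
  flagEquiv.injective h

open scoped Classical in
theorem sum_flag_ite (P : Submodule K (Fin d → K) → Prop) :
    (∑ H : Flag K 2 d, if P (H.sub 1) then (1 : ℂ) else 0) =
      Nat.card {H : Submodule K (Fin d → K) // P H} := by
  rw [Finset.sum_boole, ← Nat.card_congr ((flagEquiv (K := K) (d := d)).subtypeEquiv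
    (p := fun H => P (H.sub 1)) fun _ => Iff.rfl), Nat.card_eq_fintype_card, Fintype.card_subtype]

theorem posFun_congr {r s a : ℕ}
    {X Y : Submodule K (Fin d → K) → Submodule K (Fin d → K) → Set (Fin d → K)}
    (h : ∀ F G : Submodule K (Fin d → K), finrank K F = r → finrank K G = s →
      finrank K (F ⊓ G : Submodule K (Fin d → K)) = a → ∀ w, w ∈ X F G ↔ w ∈ Y F G) :
    posFun K d r s a X = posFun K d r s a Y := by
  classical
  ext F G w
  refine if_congr ?_ rfl rfl
  constructor
  · rintro ⟨h1, h2, h3, h4⟩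
    exact ⟨h1, h2, h3, (h _ _ h1 h2 h3 w).mp h4⟩
  · rintro ⟨h1, h2, h3, h4⟩
    exact ⟨h1, h2, h3, (h _ _ h1 h2 h3 w).mpr h4⟩

theorem Tq_val {A : Matrix (Fin 2) (Fin 2) ℕ} {Δ : Finset (Fin 2 × Fin 2)}
    (hA : IsDecorated d A Δ) :
    (Tq K d A Δ).1 =
      posFun K d (A 0 0 + A 0 1) (A 0 0 + A 1 0) (A 0 0) fun F G => {w | MarkedAt Δ F G w} := by
  classical
  ext F G w
  exact if_congr (inOrbit_iff hA) rfl rfl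

theorem infFun_eq_zero (C : (Fin d → K) → Prop) {r s a : ℕ} (h : d < r + s - a ∨ r < a ∨ s < a) :
    infFun K d C r s a = 0 := by
  ext F G w
  simp only [infFun, posFun, MirFun.zero_apply]
  rw [if_neg]
  rintro ⟨h1, h2, h3, -⟩
  have hS := Submodule.finrank_sup_add_finrank_inf_eq (F.sub 1) (G.sub 1)
  have hd := Submodule.finrank_le (F.sub 1 ⊔ G.sub 1)
  have h4 := Submodule.finrank_mono (R := K) (inf_le_left (a := F.sub 1) (b := G.sub 1))
  have h5 := Submodule.finrank_mono (R := K) (inf_le_right (a := F.sub 1) (b := G.sub 1))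
  rw [finrank_fin_fun] at hd
  omega

theorem infFun_ne_zero_of_eq_zero (r s : ℕ) : infFun K d (· ≠ 0) r s 0 = 0 := by
  ext F G w
  simp only [infFun, posFun, MirFun.zero_apply]
  rw [if_neg]
  rintro ⟨-, -, h3, h4, h5⟩
  rw [Submodule.finrank_eq_zero.mp h3] at h4
  exact h5 h4

theorem zeroFun_eq_infFun (r s a : ℕ) : zeroFun K d r s a = infFun K d (· = 0) r s a :=
  posFun_congr fun F G _ _ _ w => by
    simp only [Set.mem_singleton_iff, Set.mem_ofPred_eq]
    exact ⟨fun h => ⟨h ▸ zero_mem _, h⟩, fun h => h.2⟩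

/-! ### Convolution products -/

open scoped Classical in
theorem zeroFun_mul_apply (r s a : ℕ) (φ : MirFun K 2 d) (F G : Flag K 2 d) (w : Fin d → K) :
    (zeroFun K d r s a * φ) F G w = ∑ H : Flag K 2 d,
      if finrank K (F.sub 1) = r ∧ finrank K (H.sub 1) = s ∧
        finrank K (F.sub 1 ⊓ H.sub 1 : Submodule K (Fin d → K)) = a then φ H G w else 0 := by
  rw [MirFun.mul_apply]
  refine Finset.sum_congr rfl fun H _ => ?_
  rw [Finset.sum_eq_single 0]
  · simp [zeroFun, posFun]
  · intro u _ hu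
    simp [zeroFun, posFun, hu]
  · simp

open scoped Classical in
theorem mul_zeroFun_apply (r s a : ℕ) (φ : MirFun K 2 d) (F G : Flag K 2 d) (w : Fin d → K) :
    (φ * zeroFun K d r s a) F G w = ∑ H : Flag K 2 d,
      if finrank K (H.sub 1) = r ∧ finrank K (G.sub 1) = s ∧
        finrank K (H.sub 1 ⊓ G.sub 1 : Submodule K (Fin d → K)) = a then φ F H w else 0 := by
  rw [MirFun.mul_apply]
  refine Finset.sum_congr rfl fun H _ => ?_
  rw [Finset.sum_eq_single w]
  · simp [zeroFun, posFun]
  · intro u _ hu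
    simp [zeroFun, posFun, sub_eq_zero, hu.symm]
  · simp

omit [Fintype K] in
theorem finrank_inf_self (F : Submodule K (Fin d → K)) :
    finrank K (F ⊓ F : Submodule K (Fin d → K)) = finrank K F := by
  rw [inf_idem]

omit [Fintype K] in
theorem Flag.eq_of_finrank {F H : Flag K 2 d} {r : ℕ} (h1 : finrank K (F.sub 1) = r)
    (h2 : finrank K (H.sub 1) = r)
    (h3 : finrank K (F.sub 1 ⊓ H.sub 1 : Submodule K (Fin d → K)) = r) : F = H := by
  refine Flag.eq_of_sub_one_eq ?_
  have e1 := Submodule.eq_of_le_of_finrank_eq (inf_le_left (a := F.sub 1) (b := H.sub 1))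
    (by omega)
  have e2 := Submodule.eq_of_le_of_finrank_eq (inf_le_right (a := F.sub 1) (b := H.sub 1))
    (by omega)
  rw [← e1]
  exact e2

open scoped Classical in
-- Equal dimensions of `F`, `H` and `F ∩ H` force `H = F`, so only the sum over vectors survives.
theorem posFun_diag_mul_apply (r : ℕ)
    (X : Submodule K (Fin d → K) → Submodule K (Fin d → K) → Set (Fin d → K))
    (φ : MirFun K 2 d) (F G : Flag K 2 d) (w : Fin d → K) :
    (posFun K d r r r X * φ) F G w = if finrank K (F.sub 1) = r then
      ∑ u, (if u ∈ X (F.sub 1) (F.sub 1) then φ F G (w - u) else 0) else 0 := by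
  rw [MirFun.mul_apply, Finset.sum_eq_single F]
  · split_ifs with h <;> simp [posFun, h, finrank_inf_self]
  · intro H _ hH
    refine Finset.sum_eq_zero fun u _ => ?_
    rw [posFun, if_neg, zero_mul]
    rintro ⟨h1, h2, h3, -⟩
    exact hH (Flag.eq_of_finrank h1 h2 h3).symm
  · simp

open scoped Classical in
theorem mul_posFun_diag_apply (r : ℕ)
    (X : Submodule K (Fin d → K) → Submodule K (Fin d → K) → Set (Fin d → K))
    (φ : MirFun K 2 d) (F G : Flag K 2 d) (w : Fin d → K) :
    (φ * posFun K d r r r X) F G w = if finrank K (G.sub 1) = r then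
      ∑ u, (if w - u ∈ X (G.sub 1) (G.sub 1) then φ F G u else 0) else 0 := by
  rw [MirFun.mul_apply, Finset.sum_eq_single G]
  · split_ifs with h <;> simp [posFun, h, finrank_inf_self]
  · intro H _ hH
    refine Finset.sum_eq_zero fun u _ => ?_
    rw [posFun, if_neg, mul_zero]
    rintro ⟨h1, h2, h3, -⟩
    exact hH (Flag.eq_of_finrank h1 h2 h3)
  · simp

theorem posFun_diag_mul_zeroFun (r s a : ℕ)
    (X : Submodule K (Fin d → K) → Submodule K (Fin d → K) → Set (Fin d → K)) :
    posFun K d r r r X * zeroFun K d r s a = posFun K d r s a fun F _ => X F F := by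
  ext F G w
  rw [posFun_diag_mul_apply, Finset.sum_eq_single w]
  · simp only [zeroFun, posFun, sub_self, Set.mem_singleton_iff, and_true]
    split_ifs <;> tauto
  · intro u _ hu
    simp [zeroFun, posFun, sub_eq_zero, hu.symm]
  · simp

theorem zeroFun_mul_posFun_diag (r s a : ℕ)
    (X : Submodule K (Fin d → K) → Submodule K (Fin d → K) → Set (Fin d → K)) :
    zeroFun K d r s a * posFun K d s s s X = posFun K d r s a fun _ G => X G G := by
  ext F G w
  rw [mul_posFun_diag_apply, Finset.sum_eq_single 0]
  · rw [sub_zero]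
    simp only [zeroFun, posFun, Set.mem_singleton_iff, and_true]
    split_ifs <;> tauto
  · intro u _ hu
    simp [zeroFun, posFun, hu]
  · simp

theorem posFun_mul_zeroFun_diag (r s a t : ℕ)
    (X : Submodule K (Fin d → K) → Submodule K (Fin d → K) → Set (Fin d → K)) :
    posFun K d r s a X * zeroFun K d t t t = if s = t then posFun K d r s a X else 0 := by
  ext F G w
  rw [zeroFun, mul_posFun_diag_apply, Finset.sum_eq_single w]
  · simp only [sub_self, Set.mem_singleton_iff, if_true]
    by_cases hst : s = t
    · subst hst
      simp only [posFun, if_true]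
      split_ifs <;> tauto
    · rw [if_neg hst, MirFun.zero_apply]
      simp only [posFun]
      split_ifs with h1 h2
      · exact absurd (h2.2.1.symm.trans h1) hst
      · rfl
      · rfl
  · intro u _ hu
    simp [sub_eq_zero, hu.symm]
  · simp

/-- The decompositions of `w` in `F + G` form a coset of `F ∩ G`. -/
theorem card_mem_and_sub_mem (F G : Submodule K (Fin d → K)) {w : Fin d → K} (hw : w ∈ F ⊔ G) :
    Nat.card {u // u ∈ F ∧ w - u ∈ G} =
      Fintype.card K ^ finrank K (F ⊓ G : Submodule K (Fin d → K)) := by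
  obtain ⟨x, hx, y, hy, rfl⟩ := Submodule.mem_sup.mp hw
  rw [← Nat.card_eq_fintype_card, ← Module.natCard_eq_pow_finrank (K := K)]
  refine Nat.card_congr
    { toFun := fun u => ⟨u.1 - x, F.sub_mem u.2.1 hx, ?_⟩
      invFun := fun z => ⟨z.1 + x, F.add_mem z.2.1 hx, ?_⟩
      left_inv := fun u => by simp
      right_inv := fun z => by simp }
  · have := G.sub_mem hy u.2.2
    rwa [show y - (x + y - u.1) = u.1 - x by abel] at this
  · rw [show x + y - (z.1 + x) = y - z.1 by abel]
    exact G.sub_mem hy z.2.2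

theorem left_mul_right (r s a : ℕ) :
    posFun K d r r r (fun F _ => F) * posFun K d r s a (fun _ G => G) =
      ((Fintype.card K : ℂ) ^ a) • posFun K d r s a fun F G => ((F ⊔ G : Submodule K _) : Set _) := by
  classical
  ext F G w
  rw [posFun_diag_mul_apply, MirFun.smul_apply]
  simp only [posFun, SetLike.mem_coe]
  by_cases h : finrank K (F.sub 1) = r ∧ finrank K (G.sub 1) = s ∧
    finrank K (F.sub 1 ⊓ G.sub 1 : Submodule K (Fin d → K)) = a
  · obtain ⟨h1, h2, h3⟩ := h
    simp only [h1, h2, h3, true_and, if_true, ← ite_and]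
    rw [Finset.sum_boole, ← Fintype.card_subtype, ← Nat.card_eq_fintype_card]
    split_ifs with hw
    · rw [card_mem_and_sub_mem _ _ hw, h3]
      simp
    · rw [mul_zero, Nat.cast_eq_zero, Nat.card_eq_zero]
      refine Or.inl ⟨fun u => hw ?_⟩
      rw [← add_sub_cancel u.1 w]
      exact Submodule.add_mem_sup u.2.1 u.2.2
  · have h' : ∀ p : Prop, ¬ (finrank K (F.sub 1) = r ∧ finrank K (G.sub 1) = s ∧
      finrank K (F.sub 1 ⊓ G.sub 1 : Submodule K (Fin d → K)) = a ∧ p) := fun p hp =>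
        h ⟨hp.1, hp.2.1, hp.2.2.1⟩
    simp [h']

omit [Fintype K] in
theorem finrank_inf_of_hyperplane {F G H : Submodule K (Fin d → K)} (hH : H ≤ F)
    (hd : finrank K H + 1 = finrank K F) :
    (F ⊓ G ≤ H → H ⊓ G = F ⊓ G) ∧ (¬ F ⊓ G ≤ H →
      finrank K (H ⊓ G : Submodule K (Fin d → K)) + 1 =
        finrank K (F ⊓ G : Submodule K (Fin d → K))) := by
  constructor
  · intro h
    exact le_antisymm (inf_le_inf_right _ hH) (le_inf h inf_le_right)
  · intro h
    have h1 := Submodule.finrank_sup_add_finrank_inf_eq H (F ⊓ G)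
    rw [← inf_assoc, inf_eq_left.mpr hH] at h1
    have h2 : H ⊔ F ⊓ G ≤ F := sup_le hH inf_le_left
    have h3 : H < H ⊔ F ⊓ G := left_lt_sup.mpr h
    have h4 := Submodule.finrank_mono h2
    have h5 := Submodule.finrank_lt_finrank_of_lt h3
    omega

open scoped Classical in
-- By `finrank_inf_of_hyperplane`, `H ∩ G` is either `F ∩ G` or of codimension one in it. In the
-- first case the hyperplanes `H ⊇ F ∩ G` are counted, and `w ∈ H` is automatic. In the second case
-- those with `w ∈ H` but `F ∩ G ⊄ H` are counted; this is where the dimension of `⟨w⟩` enters.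
theorem card_hyperplanes_inf {F : Submodule K (Fin d → K)} (G : Submodule K (Fin d → K)) {r : ℕ}
    (a : ℕ) (hF : finrank K F = r + 1) (w : Fin d → K) :
    ((Fintype.card K : ℂ) - 1) * (Nat.card {H : Submodule K (Fin d → K) // H ≤ F ∧
        finrank K H + 1 = finrank K F ∧ finrank K (H ⊓ G : Submodule K (Fin d → K)) = a ∧
          w ∈ H ⊓ G} : ℂ) =
      if w ∈ F ⊓ G then
        if finrank K (F ⊓ G : Submodule K (Fin d → K)) = a then
          (Fintype.card K : ℂ) ^ (r + 1 - a) - 1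
        else if finrank K (F ⊓ G : Submodule K (Fin d → K)) = a + 1 then
          (Fintype.card K : ℂ) ^ (r + 1 - finrank K (Submodule.span K {w})) -
            (Fintype.card K : ℂ) ^ (r - a)
        else 0
      else 0 := by
  have hcard : (Fintype.card K : ℂ) = Nat.card K := by rw [Nat.card_eq_fintype_card]
  have hq : 1 ≤ Nat.card K := Nat.card_pos
  rw [hcard]
  split_ifs with hw h1 h1
  · have h := sub_one_mul_card_hyperplanes_of_le (inf_le_left (a := F) (b := G))
    have h' := congrArg (Nat.cast (R := ℂ)) h
    rw [Nat.cast_mul, Nat.cast_sub hq, Nat.cast_sub (Nat.one_le_pow _ _ hq)] at h'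
    push_cast at h'
    rw [hF, h1] at h'
    rw [← h', hF]
    congr 2
    refine Nat.card_congr (Equiv.subtypeEquivRight fun H => ?_)
    refine and_congr_right fun hH => and_congr_right fun hd => ?_
    have key := finrank_inf_of_hyperplane (G := G) hH (by omega)
    constructor
    · intro h2
      by_contra hn
      have := key.2 hn
      omega
    · intro h2
      rw [key.1 h2]
      exact ⟨h1, hw⟩
  · have hwF : Submodule.span K {w} ≤ F ⊓ G := (Submodule.span_singleton_le_iff_mem _ _).mpr hw
    have h := sub_one_mul_card_hyperplanes_not_le hwF (inf_le_left (a := F) (b := G))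
    rw [hF, h1, Nat.add_sub_add_right] at h
    rw [← h, hF]
    congr 2
    refine Nat.card_congr (Equiv.subtypeEquivRight fun H => ?_)
    refine and_congr_right fun hH => and_congr_right fun hd => ?_
    have key := finrank_inf_of_hyperplane (G := G) hH (by omega)
    rw [Submodule.span_singleton_le_iff_mem]
    constructor
    · rintro ⟨h2, h3⟩
      refine ⟨h3.1, fun h4 => ?_⟩
      rw [key.1 h4] at h2
      omega
    · rintro ⟨h2, h3⟩
      have := key.2 h3
      exact ⟨by omega, h2, hw.2⟩
  all_goals
    rw [mul_eq_zero, Nat.cast_eq_zero, Nat.card_eq_zero]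
    refine Or.inr (Or.inl ⟨fun H => ?_⟩)
    obtain ⟨H, hH, hd, h2, h3⟩ := H
  · have key := finrank_inf_of_hyperplane (G := G) hH (by omega)
    by_cases h4 : F ⊓ G ≤ H
    · rw [key.1 h4] at h2
      contradiction
    · have := key.2 h4
      omega
  · exact hw ⟨hH h3.1, h3.2⟩

end Convolution

/-! ### One-step recursions in the dimensions, and vectors outside the first subspace -/

section Steps

variable {K : Type} [Field K] [Fintype K] {d : ℕ}

/-- The condition `C` stands for `w = 0` (`ε = 0`) or `w ≠ 0` (`ε = 1`), so that both cases share
one formula. -/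
theorem step_value {C : (Fin d → K) → Prop} {ε : ℕ}
    (hC : ∀ w, C w → finrank K (Submodule.span K {w}) = ε) (r a : ℕ)
    {F G : Submodule K (Fin d → K)} {w : Fin d → K} (hF : finrank K F = r + 1) (hw : C w) :
    ((Fintype.card K : ℂ) - 1) * (Nat.card {H : Submodule K (Fin d → K) // H ≤ F ∧
        finrank K H + 1 = finrank K F ∧ finrank K (H ⊓ G : Submodule K (Fin d → K)) = a ∧
          w ∈ H ⊓ G} : ℂ) =
      ((Fintype.card K : ℂ) ^ (r + 1 - a) - 1) * (open scoped Classical in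
        if finrank K (F ⊓ G : Submodule K (Fin d → K)) = a ∧ w ∈ F ⊓ G then 1 else 0) +
      ((Fintype.card K : ℂ) ^ (r + 1 - ε) - (Fintype.card K : ℂ) ^ (r - a)) *
        (open scoped Classical in
        if finrank K (F ⊓ G : Submodule K (Fin d → K)) = a + 1 ∧ w ∈ F ⊓ G then 1 else 0) := by
  rw [card_hyperplanes_inf G a hF w, hC w hw]
  by_cases h1 : w ∈ F ⊓ G
  · by_cases h2 : finrank K (F ⊓ G : Submodule K (Fin d → K)) = a
    · simp [h1, h2]
    · simp [h1, h2]
  · simp [h1]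

/-- The left factor forces `H` to be a hyperplane of `F` and leaves `w` unchanged, so the value of
the product is the count in `step_value`. -/
theorem zeroFun_mul_infFun {C : (Fin d → K) → Prop} {ε : ℕ}
    (hC : ∀ w, C w → finrank K (Submodule.span K {w}) = ε) (r s a : ℕ) :
    ((Fintype.card K : ℂ) - 1) • (zeroFun K d (r + 1) r r * infFun K d C r s a) =
      ((Fintype.card K : ℂ) ^ (r + 1 - a) - 1) • infFun K d C (r + 1) s a +
      ((Fintype.card K : ℂ) ^ (r + 1 - ε) - (Fintype.card K : ℂ) ^ (r - a)) •
        infFun K d C (r + 1) s (a + 1) := by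
  classical
  ext F G w
  simp only [MirFun.smul_apply, MirFun.add_apply, zeroFun_mul_apply]
  by_cases h : finrank K (F.sub 1) = r + 1 ∧ finrank K (G.sub 1) = s ∧ C w
  · obtain ⟨h1, h2, h3⟩ := h
    have h4 : ∀ b, infFun K d C (r + 1) s b F G w =
        if finrank K (F.sub 1 ⊓ G.sub 1 : Submodule K (Fin d → K)) = b ∧
          w ∈ F.sub 1 ⊓ G.sub 1 then 1 else 0 := fun b => by
      simp only [infFun, posFun, h1, h2, h3, true_and, and_true, Set.mem_ofPred_eq]
    rw [h4, h4, ← step_value hC r a h1 h3, ← sum_flag_ite]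
    congr 1
    refine Finset.sum_congr rfl fun H _ => ?_
    simp only [infFun, posFun, h1, h2, h3, true_and, and_true, Set.mem_ofPred_eq, ← ite_and]
    refine if_congr ?_ rfl rfl
    constructor
    · rintro ⟨⟨h5, h6⟩, -, h7, h8⟩
      refine ⟨?_, by omega, h7, h8⟩
      rw [← inf_eq_right]
      exact Submodule.eq_of_le_of_finrank_eq inf_le_right (by omega)
    · rintro ⟨h5, h6, h7, h8⟩
      have h9 : finrank K (H.sub 1) = r := by omega
      rw [inf_eq_right.mpr h5]
      exact ⟨⟨h9, h9⟩, h9, h7, h8⟩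
  · have h4 : ∀ b, infFun K d C (r + 1) s b F G w = 0 := fun b => by
      simp only [infFun, posFun, Set.mem_ofPred_eq]
      exact if_neg fun h' => h ⟨h'.1, h'.2.1, h'.2.2.2.2⟩
    rw [h4, h4, Finset.sum_eq_zero]
    · simp
    · intro H _
      simp only [infFun, posFun, Set.mem_ofPred_eq, ← ite_and]
      exact if_neg fun h' => h ⟨h'.1.1, h'.2.2.1, h'.2.2.2.2.2⟩

theorem infFun_mul_zeroFun {C : (Fin d → K) → Prop} {ε : ℕ}
    (hC : ∀ w, C w → finrank K (Submodule.span K {w}) = ε) (r s a : ℕ) :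
    ((Fintype.card K : ℂ) - 1) • (infFun K d C r s a * zeroFun K d s (s + 1) s) =
      ((Fintype.card K : ℂ) ^ (s + 1 - a) - 1) • infFun K d C r (s + 1) a +
      ((Fintype.card K : ℂ) ^ (s + 1 - ε) - (Fintype.card K : ℂ) ^ (s - a)) •
        infFun K d C r (s + 1) (a + 1) := by
  classical
  ext F G w
  simp only [MirFun.smul_apply, MirFun.add_apply, mul_zeroFun_apply]
  by_cases h : finrank K (F.sub 1) = r ∧ finrank K (G.sub 1) = s + 1 ∧ C w
  · obtain ⟨h1, h2, h3⟩ := h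
    have h4 : ∀ b, infFun K d C r (s + 1) b F G w =
        if finrank K (G.sub 1 ⊓ F.sub 1 : Submodule K (Fin d → K)) = b ∧
          w ∈ G.sub 1 ⊓ F.sub 1 then 1 else 0 := fun b => by
      rw [inf_comm]
      simp only [infFun, posFun, h1, h2, h3, true_and, and_true, Set.mem_ofPred_eq]
    rw [h4, h4, ← step_value hC s a h2 h3, ← sum_flag_ite]
    congr 1
    refine Finset.sum_congr rfl fun H _ => ?_
    rw [inf_comm (H.sub 1) (F.sub 1)]
    simp only [infFun, posFun, h1, h2, h3, true_and, and_true, Set.mem_ofPred_eq, ← ite_and]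
    refine if_congr ?_ rfl rfl
    constructor
    · rintro ⟨⟨h5, h6⟩, -, h7, h8⟩
      refine ⟨?_, by omega, h7, h8⟩
      rw [← inf_eq_left]
      exact Submodule.eq_of_le_of_finrank_eq inf_le_left (by omega)
    · rintro ⟨h5, h6, h7, h8⟩
      have h9 : finrank K (H.sub 1) = s := by omega
      rw [inf_eq_left.mpr h5]
      exact ⟨⟨h9, h9⟩, h9, h7, h8⟩
  · have h4 : ∀ b, infFun K d C r (s + 1) b F G w = 0 := fun b => by
      simp only [infFun, posFun, Set.mem_ofPred_eq]
      exact if_neg fun h' => h ⟨h'.1, h'.2.1, h'.2.2.2.2⟩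
    rw [h4, h4, Finset.sum_eq_zero]
    · simp
    · intro H _
      simp only [infFun, posFun, Set.mem_ofPred_eq, ← ite_and]
      exact if_neg fun h' => h ⟨h'.2.1, h'.1.2.1, h'.2.2.2.2.2⟩

omit [Fintype K] in
-- If `G ≠ F` lies in `F + ⟨w⟩`, then `F < F + G ≤ F + ⟨w⟩`, and the last inclusion is an equality
-- because `F` has codimension one in `F + ⟨w⟩`.
theorem le_sup_span_singleton_iff {F G : Submodule K (Fin d → K)} {r : ℕ}
    (hF : finrank K F = r) (hG : finrank K G = r) {w : Fin d → K} (hw : w ∉ F) :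
    G ≤ F ⊔ Submodule.span K {w} ↔
      F = G ∨ F ≠ G ∧ finrank K (F ⊓ G : Submodule K (Fin d → K)) = r - 1 ∧ w ∈ F ⊔ G := by
  have hd : finrank K (F ⊔ Submodule.span K {w} : Submodule K (Fin d → K)) = finrank K F + 1 :=
    Submodule.finrank_sup_span_singleton hw
  have hS := Submodule.finrank_sup_add_finrank_inf_eq F G
  constructor
  · intro h
    by_cases hFG : F = G
    · exact Or.inl hFG
    · have h1 : F ⊔ G ≤ F ⊔ Submodule.span K {w} := sup_le le_sup_left h
      have h2 : F < F ⊔ G := by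
        refine left_lt_sup.mpr fun h3 => hFG ?_
        exact (Submodule.eq_of_le_of_finrank_eq h3 (by omega)).symm
      have h3 := Submodule.finrank_lt_finrank_of_lt h2
      have h4 := Submodule.finrank_mono h1
      have h5 := Submodule.eq_of_le_of_finrank_eq h1 (by omega)
      refine Or.inr ⟨hFG, by omega, ?_⟩
      rw [h5]
      exact Submodule.mem_sup_right (Submodule.mem_span_singleton_self w)
  · rintro (rfl | ⟨-, h1, h2⟩)
    · exact le_sup_left
    · have h3 : F ⊔ Submodule.span K {w} ≤ F ⊔ G :=
        sup_le le_sup_left ((Submodule.span_singleton_le_iff_mem _ _).mpr h2)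
      have h4 := Submodule.finrank_mono h3
      rw [Submodule.eq_of_le_of_finrank_eq h3 (by omega)]
      exact le_sup_right

/-- Functions supported on vectors outside of `F_1` arise by passing to subspaces one dimension
up. -/
theorem posFun_diff_mul_zeroFun (r : ℕ) :
    posFun K d r (r + 1) r (fun F G => (G : Set (Fin d → K)) \ F) * zeroFun K d (r + 1) r r =
      posFun K d r r r (fun F _ => (F : Set (Fin d → K))ᶜ) +
      posFun K d r r (r - 1) fun F G => ((F ⊔ G : Submodule K _) : Set (Fin d → K)) \ F := by
  classical
  ext F G w
  simp only [MirFun.add_apply, mul_zeroFun_apply]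
  by_cases h : finrank K (F.sub 1) = r ∧ finrank K (G.sub 1) = r ∧ w ∉ F.sub 1
  · obtain ⟨h1, h2, h3⟩ := h
    have hd : finrank K (F.sub 1 ⊔ Submodule.span K {w} : Submodule K (Fin d → K)) =
      finrank K (F.sub 1) + 1 := Submodule.finrank_sup_span_singleton h3
    have key := le_sup_span_singleton_iff h1 h2 h3
    let H₀ : Flag K 2 d := flagEquiv.symm (F.sub 1 ⊔ Submodule.span K {w})
    have hH₀ : H₀.sub 1 = F.sub 1 ⊔ Submodule.span K {w} := rfl
    have hFG : F.sub 1 = G.sub 1 ↔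
        finrank K (F.sub 1 ⊓ G.sub 1 : Submodule K (Fin d → K)) = r := by
      constructor
      · intro h4
        rw [← h4, finrank_inf_self, h1]
      · exact fun h4 => congrArg (fun F => F.sub 1) (Flag.eq_of_finrank h1 h2 h4)
    -- The middle subspace `H` has dimension `r + 1` and contains `F` and `w ∉ F`, so `H = F + ⟨w⟩`;
    -- the remaining condition is `G ≤ H`.
    trans if G.sub 1 ≤ F.sub 1 ⊔ Submodule.span K {w} then 1 else 0
    · rw [Finset.sum_eq_single H₀]
      · simp only [posFun, h1, h2, h3, true_and, Set.mem_sdiff, SetLike.mem_coe, ← ite_and]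
        refine if_congr ?_ rfl rfl
        rw [hH₀, hd, h1,
          show F.sub 1 ⊓ (F.sub 1 ⊔ Submodule.span K {w}) = F.sub 1 from inf_sup_self, h1]
        constructor
        · rintro ⟨⟨-, h4⟩, -⟩
          rw [← inf_eq_right]
          exact Submodule.eq_of_le_of_finrank_eq inf_le_right (by omega)
        · intro h4
          rw [inf_eq_right.mpr h4]
          exact ⟨⟨rfl, h2⟩, rfl, rfl,
            Submodule.mem_sup_right (Submodule.mem_span_singleton_self w), not_false⟩
      · intro H _ hH
        simp only [posFun, h1, h2, h3, true_and, Set.mem_sdiff, SetLike.mem_coe, ← ite_and]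
        rw [if_neg]
        rintro ⟨-, h4, h5, h6, -⟩
        refine hH (Flag.eq_of_sub_one_eq ?_)
        have h7 : F.sub 1 ≤ H.sub 1 := by
          rw [← inf_eq_left]
          exact Submodule.eq_of_le_of_finrank_eq inf_le_left (by omega)
        rw [hH₀]
        exact (Submodule.eq_of_le_of_finrank_eq
          (sup_le h7 ((Submodule.span_singleton_le_iff_mem _ _).mpr h6)) (by omega)).symm
      · simp
    · simp only [posFun, h1, h2, h3, true_and, Set.mem_sdiff, SetLike.mem_coe, Set.mem_compl_iff,
        not_false_eq_true, and_true, ← hFG]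
      by_cases h4 : F.sub 1 = G.sub 1
      -- This covers `r = 0` as well: there `r - 1 = r`, and the second summand vanishes because `w
      -- ∉ F = F + G`.
      · have h5 : w ∉ F.sub 1 ⊔ G.sub 1 := by rwa [← h4, sup_idem]
        rw [if_pos (key.mpr (Or.inl h4)), if_pos h4, if_neg fun h6 => h5 h6.2, add_zero]
      · rw [if_neg h4, zero_add]
        refine if_congr (key.trans ?_) rfl rfl
        simp [h4]
  · rw [Finset.sum_eq_zero]
    · simp only [posFun]
      rw [if_neg fun h' => h ⟨h'.1, h'.2.1, h'.2.2.2⟩,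
        if_neg fun h' => h ⟨h'.1, h'.2.1, h'.2.2.2.2⟩, add_zero]
    · intro H _
      simp only [posFun, ← ite_and]
      exact if_neg fun h' => h ⟨h'.2.1, h'.1.2.1, h'.2.2.2.2.2⟩

end Steps

/-! ### Elements of the generic algebra as families of functions -/

section Generic

variable {d : ℕ}

theorem posFun_sdiff_add {K : Type} [Field K] [Fintype K] (r s a : ℕ)
    {X Y : Submodule K (Fin d → K) → Submodule K (Fin d → K) → Set (Fin d → K)}
    (h : ∀ F G, Y F G ⊆ X F G) :
    posFun K d r s a (fun F G => X F G \ Y F G) + posFun K d r s a Y = posFun K d r s a X := by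
  classical
  ext F G w
  have hw := @h (F.sub 1) (G.sub 1) w
  simp only [MirFun.add_apply, posFun, Set.mem_sdiff]
  by_cases h1 : w ∈ Y (F.sub 1) (G.sub 1)
  · simp [h1, hw h1]
  · simp [h1]

/-- The inclusion of the invariant functions into all functions. -/
def MUq.val (K : Type) [Field K] [Fintype K] (n d : ℕ) : MUq K n d →+* MirFun K n d :=
  (invariants K n d).val.toRingHom

variable (d) in
/-- An element of the generic algebra as a family of functions. -/
def toFam : genericSubalgebra 2 d →+* ∀ q : Nat.Primes × ℕ+, MirFun (Fq q) 2 d :=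
  (RingHom.pi fun q => (MUq.val (Fq q) 2 d).comp (Pi.evalRingHom _ q)).comp
    (genericSubalgebra 2 d).val.toRingHom

theorem toFam_injective : Function.Injective (toFam d) := by
  intro g h hgh
  refine Subtype.ext (funext fun q => Subtype.ext ?_)
  exact congrFun hgh q

theorem toFam_smul (p : ℂ[T;T⁻¹]) (g : genericSubalgebra 2 d) :
    toFam d (p • g) = fun q => specialize (Fq q) p • toFam d g q := rfl

theorem specialize_T (K : Type) [Field K] [Fintype K] (m : ℕ) :
    specialize K (LaurentPolynomial.T m) = (Fintype.card K : ℂ) ^ m := by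
  simp [specialize]

theorem algebraMap_T (m : ℤ) :
    algebraMap ℂ[T;T⁻¹] (RatFunc ℂ) (LaurentPolynomial.T m) = (v ^ 2) ^ m := by
  change LaurentPolynomial.eval₂ _ _ _ = _
  simp

theorem v_ne_zero : v ≠ 0 := RatFunc.X_ne_zero

theorem v_zpow_injective : Function.Injective fun m : ℤ => v ^ m := by
  have key : ∀ m : ℤ, (v ^ m).intDegree = m := by
    have hn : ∀ n : ℕ, (v ^ n).intDegree = n := by
      intro n
      induction n with
      | zero => simp
      | succ n ih =>
        rw [pow_succ, RatFunc.intDegree_mul (pow_ne_zero _ v_ne_zero) v_ne_zero, ih, v,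
          RatFunc.intDegree_X]
        simp
    intro m
    obtain ⟨n, rfl | rfl⟩ := m.eq_nat_or_neg
    · rw [zpow_natCast, hn]
    · rw [zpow_neg, zpow_natCast, RatFunc.intDegree_inv, hn]
  intro m n h
  have := congrArg RatFunc.intDegree h
  simpa [key] using this

theorem algebraMap_T_sub_one_ne_zero {m : ℕ} (hm : m ≠ 0) :
    algebraMap ℂ[T;T⁻¹] (RatFunc ℂ) (LaurentPolynomial.T m - 1) ≠ 0 := by
  rw [map_sub, map_one, algebraMap_T, sub_ne_zero, zpow_natCast, ← pow_mul, ← zpow_natCast]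
  intro h
  have := v_zpow_injective (h.trans (zpow_zero v).symm)
  omega

theorem one_tmul_smul (p : ℂ[T;T⁻¹]) (g : genericSubalgebra 2 d) :
    ((1 : RatFunc ℂ) ⊗ₜ[ℂ[T;T⁻¹]] (p • g) : MUv 2 d) =
      algebraMap ℂ[T;T⁻¹] (RatFunc ℂ) p • ((1 : RatFunc ℂ) ⊗ₜ[ℂ[T;T⁻¹]] g) := by
  rw [TensorProduct.tmul_smul, algebraMap_smul]

theorem one_tmul_mul (g h : genericSubalgebra 2 d) :
    ((1 : RatFunc ℂ) ⊗ₜ[ℂ[T;T⁻¹]] (g * h) : MUv 2 d) =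
      ((1 : RatFunc ℂ) ⊗ₜ[ℂ[T;T⁻¹]] g) * ((1 : RatFunc ℂ) ⊗ₜ[ℂ[T;T⁻¹]] h) := by
  rw [Algebra.TensorProduct.tmul_mul_tmul, one_mul]

/-- The family `φ` of functions comes from an element of the generic algebra whose image in
`MU_𝐯(2, d)` lies in `S`. -/
def Gen (S : Subalgebra (RatFunc ℂ) (MUv 2 d)) (φ : ∀ q : Nat.Primes × ℕ+, MirFun (Fq q) 2 d) :
    Prop :=
  ∃ g, toFam d g = φ ∧ ((1 : RatFunc ℂ) ⊗ₜ[ℂ[T;T⁻¹]] g : MUv 2 d) ∈ S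

namespace Gen

variable {S : Subalgebra (RatFunc ℂ) (MUv 2 d)}
  {φ ψ : ∀ q : Nat.Primes × ℕ+, MirFun (Fq q) 2 d}

theorem zero : Gen S (0 : ∀ q : Nat.Primes × ℕ+, MirFun (Fq q) 2 d) :=
  ⟨0, map_zero _, by rw [TensorProduct.tmul_zero]; exact S.zero_mem⟩

theorem add (hφ : Gen S φ) (hψ : Gen S ψ) : Gen S (φ + ψ) := by
  obtain ⟨g, rfl, hg⟩ := hφ
  obtain ⟨h, rfl, hh⟩ := hψ
  exact ⟨g + h, map_add _ _ _, by rw [TensorProduct.tmul_add]; exact S.add_mem hg hh⟩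

theorem sub (hφ : Gen S φ) (hψ : Gen S ψ) : Gen S (φ - ψ) := by
  obtain ⟨g, rfl, hg⟩ := hφ
  obtain ⟨h, rfl, hh⟩ := hψ
  exact ⟨g - h, map_sub _ _ _, by rw [TensorProduct.tmul_sub]; exact S.sub_mem hg hh⟩

theorem mul (hφ : Gen S φ) (hψ : Gen S ψ) : Gen S (φ * ψ) := by
  obtain ⟨g, rfl, hg⟩ := hφ
  obtain ⟨h, rfl, hh⟩ := hψ
  exact ⟨g * h, map_mul _ _ _, by rw [one_tmul_mul]; exact S.mul_mem hg hh⟩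

theorem smul (p : ℂ[T;T⁻¹]) (hφ : Gen S φ) : Gen S fun q => specialize (Fq q) p • φ q := by
  obtain ⟨g, rfl, hg⟩ := hφ
  exact ⟨p • g, toFam_smul p g, by rw [one_tmul_smul]; exact S.smul_mem hg _⟩

/-- Division by `p` is possible in `S` but not among families. Hence `φ` must already come from some
`g` in the generic algebra; injectivity of `toFam` then identifies `p • g` with the given element.
-/
theorem of_smul {p : ℂ[T;T⁻¹]} (hp : algebraMap ℂ[T;T⁻¹] (RatFunc ℂ) p ≠ 0)
    (h : ∃ g, toFam d g = φ) (hφ : Gen S fun q => specialize (Fq q) p • φ q) : Gen S φ := by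
  obtain ⟨g, rfl⟩ := h
  obtain ⟨g', h1, h2⟩ := hφ
  rw [← toFam_smul] at h1
  rw [toFam_injective h1, one_tmul_smul] at h2
  refine ⟨g, rfl, ?_⟩
  have := S.smul_mem h2 (algebraMap ℂ[T;T⁻¹] (RatFunc ℂ) p)⁻¹
  rwa [inv_smul_smul₀ hp] at this

theorem sdiff {r s a : ℕ}
    {X Y : ∀ q : Nat.Primes × ℕ+, Submodule (Fq q) (Fin d → Fq q) →
      Submodule (Fq q) (Fin d → Fq q) → Set (Fin d → Fq q)}
    (hX : Gen S fun q => posFun (Fq q) d r s a (X q))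
    (hY : Gen S fun q => posFun (Fq q) d r s a (Y q)) (h : ∀ q F G, Y q F G ⊆ X q F G) :
    Gen S fun q => posFun (Fq q) d r s a fun F G => X q F G \ Y q F G := by
  have := hX.sub hY
  convert! this using 1
  funext q
  exact eq_sub_of_add_eq (posFun_sdiff_add r s a (h q))

theorem of_sdiff {r s a : ℕ}
    {X Y : ∀ q : Nat.Primes × ℕ+, Submodule (Fq q) (Fin d → Fq q) →
      Submodule (Fq q) (Fin d → Fq q) → Set (Fin d → Fq q)}
    (hX : Gen S fun q => posFun (Fq q) d r s a fun F G => X q F G \ Y q F G)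
    (hY : Gen S fun q => posFun (Fq q) d r s a (Y q)) (h : ∀ q F G, Y q F G ⊆ X q F G) :
    Gen S fun q => posFun (Fq q) d r s a (X q) := by
  have := hX.add hY
  convert! this using 1
  funext q
  exact (posFun_sdiff_add r s a (h q)).symm

theorem congr {r s a : ℕ}
    {X Y : ∀ q : Nat.Primes × ℕ+, Submodule (Fq q) (Fin d → Fq q) →
      Submodule (Fq q) (Fin d → Fq q) → Set (Fin d → Fq q)}
    (hX : Gen S fun q => posFun (Fq q) d r s a (X q))
    (h : ∀ q (F G : Submodule (Fq q) (Fin d → Fq q)), finrank (Fq q) F = r → finrank (Fq q) G = s →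
      finrank (Fq q) (F ⊓ G : Submodule (Fq q) (Fin d → Fq q)) = a →
      ∀ w, w ∈ X q F G ↔ w ∈ Y q F G) :
    Gen S fun q => posFun (Fq q) d r s a (Y q) := by
  convert! hX using 2 with q
  exact (posFun_congr (h q)).symm

end Gen

theorem isDecorated_empty {r s a : ℕ} (h1 : a ≤ r) (h2 : a ≤ s) (h3 : r + s - a ≤ d) :
    IsDecorated d !![a, r - a; s - a, d - (r + s - a)] ∅ := by
  refine ⟨?_, by simp, by simp⟩
  simp [Fin.sum_univ_two]
  omega

theorem IsDecorated.exists_tmul {A : Matrix (Fin 2) (Fin 2) ℕ} {Δ : Finset (Fin 2 × Fin 2)}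
    (hA : IsDecorated d A Δ) : ∃ g, T d A Δ = (1 : RatFunc ℂ) ⊗ₜ[ℂ[T;T⁻¹]] g ∧
      toFam d g = fun q => posFun (Fq q) d (A 0 0 + A 0 1) (A 0 0 + A 1 0) (A 0 0)
        fun F G => {w | MarkedAt Δ F G w} := by
  refine ⟨⟨Tfamily d A Δ, Algebra.subset_adjoin ⟨A, Δ, hA, rfl⟩⟩, ?_, ?_⟩
  · rw [T, dif_pos hA]
  · funext q
    exact Tq_val hA

end Generic

/-! ### Generation by the families `e_r`, `f_r`, `1_r`, `x_r` -/

section Generation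

variable {d : ℕ}

theorem IsDecorated.exists_tmul_zeroFun {A : Matrix (Fin 2) (Fin 2) ℕ} (hA : IsDecorated d A ∅) :
    ∃ g, T d A ∅ = (1 : RatFunc ℂ) ⊗ₜ[ℂ[T;T⁻¹]] g ∧
      toFam d g = fun q => zeroFun (Fq q) d (A 0 0 + A 0 1) (A 0 0 + A 1 0) (A 0 0) := by
  obtain ⟨g, h, hg⟩ := hA.exists_tmul
  refine ⟨g, h, hg.trans (funext fun q => posFun_congr fun F G _ _ _ w => ?_)⟩
  simp only [MarkedAt, Set.mem_ofPred_eq, Set.mem_singleton_iff]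
  constructor
  · intro h; simpa using h.1
  · rintro rfl; simp

theorem IsDecorated.exists_tmul_infFun {A : Matrix (Fin 2) (Fin 2) ℕ}
    (hA : IsDecorated d A {(0, 0)}) :
    ∃ g, T d A {(0, 0)} = (1 : RatFunc ℂ) ⊗ₜ[ℂ[T;T⁻¹]] g ∧
      toFam d g = fun q =>
        infFun (Fq q) d (· ≠ 0) (A 0 0 + A 0 1) (A 0 0 + A 1 0) (A 0 0) := by
  obtain ⟨g, h, hg⟩ := hA.exists_tmul
  refine ⟨g, h, hg.trans (funext fun q => posFun_congr fun F G _ _ _ w => ?_)⟩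
  have := @Submodule.mem_sup_left _ _ _ _ _ F G w
  simp [MarkedAt]
  tauto

/-- This and the next lemma supply the existence hypothesis of `Gen.of_smul`. For dimensions that no
pair of subspaces realizes, the function is zero. -/
theorem exists_toFam_zeroFun (r s a : ℕ) :
    ∃ g, toFam d g = fun q => infFun (Fq q) d (· = 0) r s a := by
  by_cases h : d < r + s - a ∨ r < a ∨ s < a
  · exact ⟨0, by rw [map_zero]; funext q; exact (infFun_eq_zero _ h).symm⟩
  · obtain ⟨g, -, hg⟩ := (isDecorated_empty (d := d) (r := r) (s := s) (a := a) (by omega)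
      (by omega) (by omega)).exists_tmul_zeroFun
    refine ⟨g, hg.trans (funext fun q => ?_)⟩
    rw [← zeroFun_eq_infFun]
    congr 1 <;> simp <;> omega

theorem exists_toFam_infFun (r s a : ℕ) :
    ∃ g, toFam d g = fun q => infFun (Fq q) d (· ≠ 0) r s a := by
  by_cases h : d < r + s - a ∨ r < a ∨ s < a
  · exact ⟨0, by rw [map_zero]; funext q; exact (infFun_eq_zero _ h).symm⟩
  by_cases ha : a = 0
  · subst ha
    exact ⟨0, by rw [map_zero]; funext q; exact (infFun_ne_zero_of_eq_zero _ _).symm⟩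
  · have hA : IsDecorated d !![a, r - a; s - a, d - (r + s - a)] {(0, 0)} := by
      refine ⟨(isDecorated_empty (by omega) (by omega) (by omega)).1, by simp, ?_⟩
      simpa using Nat.pos_of_ne_zero ha
    obtain ⟨g, -, hg⟩ := hA.exists_tmul_infFun
    refine ⟨g, hg.trans (funext fun q => ?_)⟩
    congr 1 <;> simp <;> omega

variable {S : Subalgebra (RatFunc ℂ) (MUv 2 d)}

/-- Induction on the defect `n = r + s - 2a`. Defect zero leaves only the diagonal functions, apart
from those that vanish because `a` exceeds `r` or `s`. -/
theorem gen_infFun (C : ∀ q : Nat.Primes × ℕ+, (Fin d → Fq q) → Prop) (ε : ℕ)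
    (hC : ∀ q w, C q w → finrank (Fq q) (Submodule.span (Fq q) {w}) = ε)
    (hfam : ∀ r s a, ∃ g, toFam d g = fun q => infFun (Fq q) d (C q) r s a)
    (hdiag : ∀ r, Gen S fun q => infFun (Fq q) d (C q) r r r)
    (he : ∀ r, Gen S fun q => zeroFun (Fq q) d (r + 1) r r)
    (hf : ∀ r, Gen S fun q => zeroFun (Fq q) d r (r + 1) r) (n : ℕ) :
    ∀ r s a, r + s = 2 * a + n → Gen S fun q => infFun (Fq q) d (C q) r s a := by
  have hzero : ∀ r s a, r < a ∨ s < a → Gen S fun q => infFun (Fq q) d (C q) r s a := by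
    intro r s a h
    convert! Gen.zero using 1
    funext q
    exact infFun_eq_zero _ (Or.inr h)
  induction n using Nat.strong_induction_on with
  | _ n ih =>
  intro r s a hn
  by_cases h0 : r < a ∨ s < a
  · exact hzero r s a h0
  have ih' : ∀ r' s' a', r' + s' < 2 * a' + n → Gen S fun q => infFun (Fq q) d (C q) r' s' a' := by
    intro r' s' a' h
    by_cases h1 : r' < a' ∨ s' < a'
    · exact hzero r' s' a' h1
    · exact ih (r' + s' - 2 * a') (by omega) r' s' a' (by omega)
  by_cases hr : a < r
  · obtain ⟨r, rfl⟩ : ∃ r', r = r' + 1 := ⟨r - 1, by omega⟩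
    refine Gen.of_smul (algebraMap_T_sub_one_ne_zero (show r + 1 - a ≠ 0 by omega))
      (hfam _ _ _) ?_
    -- The factor `infFun` with indices `r, s, a` has defect `n - 1`, and the correction term with
    -- `r + 1, s, a + 1` has defect `n - 2`.
    have h1 := (((he r).mul (ih' r s a (by omega))).smul (LaurentPolynomial.T (1 : ℕ) - 1)).sub
      ((ih' (r + 1) s (a + 1) (by omega)).smul
        (LaurentPolynomial.T (r + 1 - ε : ℕ) - LaurentPolynomial.T (r - a : ℕ)))
    convert! h1 using 1
    funext q
    simp only [map_sub, map_one, specialize_T, pow_one, Pi.sub_apply, Pi.mul_apply]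
    rw [zeroFun_mul_infFun (hC q), add_sub_cancel_right]
  -- Here `r = a`, so the dimension of the second subspace is lowered instead, by right
  -- multiplication.
  by_cases hs : a < s
  · obtain ⟨s, rfl⟩ : ∃ s', s = s' + 1 := ⟨s - 1, by omega⟩
    refine Gen.of_smul (algebraMap_T_sub_one_ne_zero (show s + 1 - a ≠ 0 by omega))
      (hfam _ _ _) ?_
    have h1 := (((ih' r s a (by omega)).mul (hf s)).smul (LaurentPolynomial.T (1 : ℕ) - 1)).sub
      ((ih' r (s + 1) (a + 1) (by omega)).smul
        (LaurentPolynomial.T (s + 1 - ε : ℕ) - LaurentPolynomial.T (s - a : ℕ)))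
    convert! h1 using 1
    funext q
    simp only [map_sub, map_one, specialize_T, pow_one, Pi.sub_apply, Pi.mul_apply]
    rw [infFun_mul_zeroFun (hC q), add_sub_cancel_right]
  · obtain rfl : r = a := by omega
    obtain rfl : s = r := by omega
    exact hdiag _

/-- A subalgebra `S` that contains the elements `1_r`, `x_r`, `e_r`, `f_r`, given as families of
functions. -/
structure ContainsChevalley (S : Subalgebra (RatFunc ℂ) (MUv 2 d)) : Prop where
  one : ∀ r, Gen S fun q => zeroFun (Fq q) d r r r
  x : ∀ r, Gen S fun q => infFun (Fq q) d (· ≠ 0) r r r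
  e : ∀ r, Gen S fun q => zeroFun (Fq q) d (r + 1) r r
  f : ∀ r, Gen S fun q => zeroFun (Fq q) d r (r + 1) r

namespace ContainsChevalley

variable (hS : ContainsChevalley S) (r s a : ℕ)
include hS

theorem gen_inf_eq_zero : Gen S fun q => infFun (Fq q) d (· = 0) r s a := by
  by_cases h : r + s < 2 * a
  · convert! Gen.zero using 1
    funext q
    exact infFun_eq_zero _ (by omega)
  · refine gen_infFun (fun q w => w = 0) 0 ?_ exists_toFam_zeroFun ?_ hS.e hS.f
      (r + s - 2 * a) r s a (by omega)
    · rintro q w rfl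
      simp
    · intro r
      simpa only [← zeroFun_eq_infFun] using hS.one r

theorem gen_zero : Gen S fun q => zeroFun (Fq q) d r s a := by
  simpa only [zeroFun_eq_infFun] using hS.gen_inf_eq_zero r s a

theorem gen_inf_ne_zero : Gen S fun q => infFun (Fq q) d (· ≠ 0) r s a := by
  by_cases h : r + s < 2 * a
  · convert! Gen.zero using 1
    funext q
    exact infFun_eq_zero _ (by omega)
  · refine gen_infFun (fun q w => w ≠ 0) 1 ?_ exists_toFam_infFun hS.x hS.e hS.f
      (r + s - 2 * a) r s a (by omega)
    intro q w hw
    exact finrank_span_singleton hw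

theorem gen_inf : Gen S fun q => posFun (Fq q) d r s a
    fun F G => ((F ⊓ G : Submodule (Fq q) _) : Set (Fin d → Fq q)) := by
  have h0 : Gen S fun q => posFun (Fq q) d r s a fun _ _ => ({0} : Set (Fin d → Fq q)) :=
    hS.gen_zero r s a
  have h1 : Gen S fun q => posFun (Fq q) d r s a
      fun F G => {w : Fin d → Fq q | w ∈ F ⊓ G ∧ w ≠ 0} := hS.gen_inf_ne_zero r s a
  refine Gen.of_sdiff h1 h0 fun q F G w hw => ?_
  obtain rfl : w = 0 := hw
  exact zero_mem (F ⊓ G)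

theorem gen_diag : Gen S fun q => posFun (Fq q) d r r r fun F _ => (F : Set (Fin d → Fq q)) := by
  refine (hS.gen_inf r r r).congr fun q F G h1 h2 h3 w => ?_
  rw [Submodule.eq_of_le_of_finrank_eq (inf_le_left (a := F) (b := G)) (by omega)]

theorem gen_left : Gen S fun q => posFun (Fq q) d r s a fun F _ => (F : Set (Fin d → Fq q)) := by
  convert! (hS.gen_diag r).mul (hS.gen_zero r s a) using 1
  funext q
  exact (posFun_diag_mul_zeroFun (K := Fq q) r s a fun F _ => (F : Set (Fin d → Fq q))).symm

theorem gen_right : Gen S fun q => posFun (Fq q) d r s a fun _ G => (G : Set (Fin d → Fq q)) := by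
  convert! (hS.gen_zero r s a).mul (hS.gen_diag s) using 1
  funext q
  exact (zeroFun_mul_posFun_diag (K := Fq q) r s a fun F _ => (F : Set (Fin d → Fq q))).symm

/-- Convolving the conditions `u ∈ F` and `w - u ∈ G` counts each `w ∈ F + G` exactly `q^a` times,
and `q^a` is a unit already in `ℂ[𝐪, 𝐪⁻¹]`. -/
theorem gen_sup : Gen S fun q => posFun (Fq q) d r s a
    fun F G => ((F ⊔ G : Submodule (Fq q) _) : Set (Fin d → Fq q)) := by
  have h := ((hS.gen_diag r).mul (hS.gen_right r s a)).smul (LaurentPolynomial.T (-a : ℤ))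
  convert! h using 1
  funext q
  rw [Pi.mul_apply, left_mul_right, smul_smul, ← specialize_T, ← map_mul,
    ← LaurentPolynomial.T_add, neg_add_cancel, LaurentPolynomial.T_zero, map_one, one_smul]

/-- Passing from `F` up to `F + ⟨w⟩` and back down to `G` gives the function of all `w ∉ F` with `F
= G`, plus a term with `dim (F ∩ G) = r - 1` that is already available. -/
theorem gen_univ_diag : Gen S fun q => posFun (Fq q) d r r r
    fun _ _ => (Set.univ : Set (Fin d → Fq q)) := by
  have h1 : Gen S fun q => posFun (Fq q) d r (r + 1) r
      fun F G => (G : Set (Fin d → Fq q)) \ F :=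
    ((hS.gen_right r (r + 1) r).sdiff (hS.gen_inf r (r + 1) r)
      fun q F G w hw => hw.2).congr fun q F G _ _ _ w => by
        simp only [Set.mem_sdiff, SetLike.mem_coe, Submodule.mem_inf]
        tauto
  have h2 : Gen S fun q => posFun (Fq q) d r r (r - 1)
      fun F G => ((F ⊔ G : Submodule (Fq q) _) : Set (Fin d → Fq q)) \ F :=
    (hS.gen_sup r r (r - 1)).sdiff (hS.gen_left r r (r - 1))
      fun q F G w hw => Submodule.mem_sup_left hw
  have h3 := (h1.mul (hS.e r)).sub h2
  refine Gen.of_sdiff (Y := fun q F _ => (F : Set (Fin d → Fq q))) ?_ (hS.gen_diag r)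
    fun q F G => Set.subset_univ _
  convert! h3 using 1
  funext q
  rw [Pi.sub_apply, Pi.mul_apply, posFun_diff_mul_zeroFun, add_sub_cancel_right]
  simp only [Set.compl_eq_univ_sdiff]

theorem gen_univ : Gen S fun q => posFun (Fq q) d r s a
    fun _ _ => (Set.univ : Set (Fin d → Fq q)) := by
  convert! (hS.gen_zero r s a).mul (hS.gen_univ_diag s) using 1
  funext q
  exact (zeroFun_mul_posFun_diag (K := Fq q) r s a fun _ _ => Set.univ).symm

theorem gen_markedAt {A : Matrix (Fin 2) (Fin 2) ℕ} {Δ : Finset (Fin 2 × Fin 2)}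
    (hA : IsDecorated d A Δ) :
    Gen S fun q => posFun (Fq q) d r s a fun F G => {w | MarkedAt Δ F G w} := by
  have inf_le : ∀ (q : Nat.Primes × ℕ+) (F G : Submodule (Fq q) (Fin d → Fq q)) w,
      w ∈ F ⊓ G → w ∈ F ⊔ G := fun q F G w hw => Submodule.mem_sup_left hw.1
  rcases antichain_cases Δ hA.2.1 with rfl | rfl | rfl | rfl | rfl | rfl
  · refine (hS.gen_inf_eq_zero r s a).congr fun q F G _ _ _ w => ?_
    simp only [MarkedAt, Set.mem_ofPred_eq]
    constructor
    · rintro ⟨-, rfl⟩; simp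
    · intro h; simp at h; simp [h.1]
  · refine (hS.gen_inf_ne_zero r s a).congr fun q F G _ _ _ w => ?_
    have := @Submodule.mem_sup_left _ _ _ _ _ F G w
    simp [MarkedAt]
    tauto
  · refine ((hS.gen_left r s a).sdiff (hS.gen_inf r s a) fun q F G w hw => hw.1).congr
      fun q F G _ _ _ w => ?_
    have h1 := @Submodule.mem_sup_left _ _ _ _ _ F G w
    have h2 : w = 0 → w ∈ G := fun h => h ▸ zero_mem _
    simp [MarkedAt]
    tauto
  · refine ((hS.gen_right r s a).sdiff (hS.gen_inf r s a) fun q F G w hw => hw.2).congr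
      fun q F G _ _ _ w => ?_
    have h1 := @Submodule.mem_sup_right _ _ _ _ _ F G w
    have h2 : w = 0 → w ∈ F := fun h => h ▸ zero_mem _
    simp [MarkedAt]
    tauto
  · refine ((hS.gen_univ r s a).sdiff (hS.gen_sup r s a) fun q F G w hw => trivial).congr
      fun q F G _ _ _ w => ?_
    have h1 := @Submodule.mem_sup_left _ _ _ _ _ F G w
    have h3 := @Submodule.mem_sup_right _ _ _ _ _ F G w
    have h2 : w = 0 → w ∈ F := fun h => h ▸ zero_mem _
    simp [MarkedAt]
    tauto
  -- Vectors of `F + G` outside `F ∪ G`. The set removed in the second step is `G \ (F ∩ G)` rather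
  -- than `G`, since `Gen.sdiff` needs it inside `(F + G) \ F`.
  · have h := ((hS.gen_sup r s a).sdiff (hS.gen_left r s a)
      fun q F G w hw => Submodule.mem_sup_left hw).sdiff
      ((hS.gen_right r s a).sdiff (hS.gen_inf r s a) fun q F G w hw => hw.2)
      fun q F G w hw => ⟨Submodule.mem_sup_right hw.1, fun h => hw.2 ⟨h, hw.1⟩⟩
    refine h.congr fun q F G _ _ _ w => ?_
    have h2 : w = 0 → w ∈ F := fun h => h ▸ zero_mem _
    simp [MarkedAt]
    tauto

/-- The subalgebra contains `1 ⊗ T_{A,Δ}` for all decorated matrices, hence `1 ⊗ g` for every `g` in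
the generic algebra, and these span over `ℂ(𝐯)`. -/
theorem eq_top : S = ⊤ := by
  have hT : ∀ g : genericSubalgebra 2 d, ((1 : RatFunc ℂ) ⊗ₜ[ℂ[T;T⁻¹]] g : MUv 2 d) ∈ S := by
    rintro ⟨g, hg⟩
    induction hg using Algebra.adjoin_induction with
    | mem x hx =>
      obtain ⟨A, Δ, hA, rfl⟩ := hx
      obtain ⟨g, h1, h2⟩ := hA.exists_tmul
      obtain ⟨g', h3, h4⟩ := hS.gen_markedAt (A 0 0 + A 0 1) (A 0 0 + A 1 0) (A 0 0) hA
      rw [toFam_injective (h3.trans h2.symm), ← h1, T, dif_pos hA] at h4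
      exact h4
    | algebraMap p =>
      have := one_tmul_smul p (1 : genericSubalgebra 2 d)
      rw [← Algebra.algebraMap_eq_smul_one] at this
      exact this ▸ S.smul_mem S.one_mem _
    | add x y hx hy h1 h2 =>
      have := S.add_mem h1 h2
      rwa [← TensorProduct.tmul_add] at this
    | mul x y hx hy h1 h2 =>
      have := S.mul_mem h1 h2
      rwa [← one_tmul_mul] at this
  rw [eq_top_iff]
  intro x _
  induction x using TensorProduct.induction_on with
  | zero => exact S.zero_mem
  | tmul c g =>
    have := S.smul_mem (hT g) c
    rwa [TensorProduct.smul_tmul', smul_eq_mul, mul_one] at this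
  | add x y hx hy => exact S.add_mem (hx trivial) (hy trivial)

end ContainsChevalley

end Generation

/-! ### The elements `e`, `f`, `k`, `ℓ` -/

section Generators

variable {d : ℕ}

/-- The element `x` of `MU_𝐯(2, d)` is the image of an element of the generic algebra that is given
by the family `φ` of functions. -/
def Rep (x : MUv 2 d) (φ : ∀ q : Nat.Primes × ℕ+, MirFun (Fq q) 2 d) : Prop :=
  ∃ g, x = (1 : RatFunc ℂ) ⊗ₜ[ℂ[T;T⁻¹]] g ∧ toFam d g = φ

namespace Rep

variable {x y : MUv 2 d} {φ ψ : ∀ q : Nat.Primes × ℕ+, MirFun (Fq q) 2 d}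

/-- Identities in `MU_𝐯(2, d)` are verified by comparing functions for each `q`. -/
theorem unique (hx : Rep x φ) (hy : Rep y φ) : x = y := by
  obtain ⟨g, rfl, hg⟩ := hx
  obtain ⟨h, rfl, hh⟩ := hy
  rw [toFam_injective (hg.trans hh.symm)]

theorem gen {S : Subalgebra (RatFunc ℂ) (MUv 2 d)} (hx : Rep x φ) (h : x ∈ S) : Gen S φ := by
  obtain ⟨g, rfl, hg⟩ := hx
  exact ⟨g, hg, h⟩

theorem zero : Rep (0 : MUv 2 d) 0 := ⟨0, (TensorProduct.tmul_zero _ _).symm, map_zero _⟩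

theorem one : Rep (1 : MUv 2 d) 1 := ⟨1, rfl, map_one _⟩

theorem add (hx : Rep x φ) (hy : Rep y ψ) : Rep (x + y) (φ + ψ) := by
  obtain ⟨g, rfl, rfl⟩ := hx
  obtain ⟨h, rfl, rfl⟩ := hy
  exact ⟨g + h, (TensorProduct.tmul_add _ _ _).symm, map_add _ _ _⟩

theorem mul (hx : Rep x φ) (hy : Rep y ψ) : Rep (x * y) (φ * ψ) := by
  obtain ⟨g, rfl, rfl⟩ := hx
  obtain ⟨h, rfl, rfl⟩ := hy
  exact ⟨g * h, (one_tmul_mul _ _).symm, map_mul _ _ _⟩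

theorem sum {x : ℕ → MUv 2 d} {φ : ℕ → ∀ q : Nat.Primes × ℕ+, MirFun (Fq q) 2 d}
    (s : Finset ℕ) (h : ∀ i ∈ s, Rep (x i) (φ i)) : Rep (∑ i ∈ s, x i) (∑ i ∈ s, φ i) := by
  classical
  induction s using Finset.induction_on with
  | empty => exact zero
  | insert i s hi ih =>
    rw [Finset.sum_insert hi, Finset.sum_insert hi]
    exact (h i (Finset.mem_insert_self i s)).add
      (ih fun j hj => h j (Finset.mem_insert_of_mem hj))

end Rep

theorem rep_oneElt {r : ℕ} (hr : r ≤ d) :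
    Rep (oneElt d r) fun q => zeroFun (Fq q) d r r r := by
  have hA : IsDecorated d !![r, 0; 0, d - r] ∅ := by
    refine ⟨?_, by simp, by simp⟩
    simp [Fin.sum_univ_two]
    omega
  exact hA.exists_tmul_zeroFun

theorem rep_eElt {r : ℕ} (hr : r < d) :
    Rep (eElt d r) fun q => zeroFun (Fq q) d (r + 1) r r := by
  have hA : IsDecorated d !![r, 1; 0, d - r - 1] ∅ := by
    refine ⟨?_, by simp, by simp⟩
    simp [Fin.sum_univ_two]
    omega
  exact hA.exists_tmul_zeroFun

theorem rep_fElt {r : ℕ} (hr : r < d) :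
    Rep (fElt d r) fun q => zeroFun (Fq q) d r (r + 1) r := by
  have hA : IsDecorated d !![r, 0; 1, d - r - 1] ∅ := by
    refine ⟨?_, by simp, by simp⟩
    simp [Fin.sum_univ_two]
    omega
  exact hA.exists_tmul_zeroFun

theorem rep_xElt {r : ℕ} (h0 : 0 < r) (hr : r ≤ d) :
    Rep (xElt d r) fun q => infFun (Fq q) d (· ≠ 0) r r r := by
  have hA : IsDecorated d !![r, 0; 0, d - r] {(0, 0)} := by
    refine ⟨?_, by simp, by simpa using h0⟩
    simp [Fin.sum_univ_two]
    omega
  exact hA.exists_tmul_infFun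

theorem Rep.mul_oneElt {x : MUv 2 d} {r s a t : ℕ}
    {X : ∀ q : Nat.Primes × ℕ+, Submodule (Fq q) (Fin d → Fq q) →
      Submodule (Fq q) (Fin d → Fq q) → Set (Fin d → Fq q)}
    (hx : Rep x fun q => posFun (Fq q) d r s a (X q)) (ht : t ≤ d) :
    x * oneElt d t = if s = t then x else 0 := by
  refine (hx.mul (rep_oneElt ht)).unique ?_
  split_ifs with h
  · convert! hx using 1
    funext q
    rw [Pi.mul_apply, posFun_mul_zeroFun_diag, if_pos h]
  · convert! Rep.zero using 1
    funext q
    rw [Pi.mul_apply, posFun_mul_zeroFun_diag, if_neg h]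
    rfl

/-- The unit is split according to the dimension of the common subspace. -/
theorem sum_zeroFun_diag {K : Type} [Field K] [Fintype K] :
    ∑ r ∈ Finset.range (d + 1), zeroFun K d r r r = 1 := by
  classical
  have hsum : ∀ (s : Finset ℕ) (F G : Flag K 2 d) (w : Fin d → K),
      (∑ r ∈ s, zeroFun K d r r r) F G w = ∑ r ∈ s, zeroFun K d r r r F G w := by
    intro s F G w
    induction s using Finset.induction_on with
    | empty => rfl
    | insert i s hi ih => rw [Finset.sum_insert hi, Finset.sum_insert hi, MirFun.add_apply, ih]
  ext F G w
  rw [hsum, MirFun.one_apply, Finset.sum_eq_single (finrank K (F.sub 1))]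
  · simp only [zeroFun, posFun, true_and, Set.mem_singleton_iff]
    refine if_congr ?_ rfl rfl
    constructor
    · rintro ⟨h1, h2, h3⟩
      exact ⟨Flag.eq_of_finrank rfl h1 h2, h3⟩
    · rintro ⟨rfl, h⟩
      exact ⟨rfl, finrank_inf_self _, h⟩
  · intro r _ hr
    exact if_neg fun h => hr h.1.symm
  · intro h
    have := Submodule.finrank_le (F.sub 1)
    rw [finrank_fin_fun] at this
    exact absurd (Finset.mem_range.mpr (Nat.lt_succ_iff.mpr this)) h

theorem sum_oneElt : ∑ r ∈ Finset.range (d + 1), oneElt d r = 1 := by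
  classical
  refine (Rep.sum _ fun r hr => rep_oneElt (Nat.lt_succ_iff.mp (Finset.mem_range.mp hr))).unique ?_
  convert! Rep.one using 1
  funext q
  rw [Finset.sum_apply]
  exact sum_zeroFun_diag

theorem aeval_mul_of_mul_eq_smul {R B : Type*} [CommRing R] [Ring B] [Algebra R B] {x y : B} {c : R}
    (h : x * y = c • y) (p : Polynomial R) : Polynomial.aeval x p * y = p.eval c • y := by
  induction p using Polynomial.induction_on' with
  | add p p' h1 h2 => rw [map_add, add_mul, h1, h2, Polynomial.eval_add, add_smul]
  | monomial n r =>
    have hn : x ^ n * y = c ^ n • y := by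
      induction n with
      | zero => simp
      | succ n ih => rw [pow_succ, mul_assoc, h, mul_smul_comm, ih, smul_smul, pow_succ']
    rw [Polynomial.aeval_monomial, mul_assoc, hn, Polynomial.eval_monomial, mul_smul_comm,
      Algebra.algebraMap_eq_smul_one, smul_mul_assoc, one_mul, smul_smul, mul_comm r]

/-- Lagrange interpolation: a polynomial in `x` that vanishes at all other eigenvalues is a nonzero
multiple of `u t`. -/
theorem eigenprojection_mem {R B : Type*} [Field R] [Ring B] [Algebra R B] {S : Subalgebra R B}
    {x : B} {u : ℕ → B} {c : ℕ → R} {n : ℕ} (hu : ∑ r ∈ Finset.range n, u r = 1)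
    (hx : ∀ r < n, x * u r = c r • u r) (hc : Function.Injective c) (hS : x ∈ S) {t : ℕ}
    (ht : t < n) : u t ∈ S := by
  let p : Polynomial R := ∏ r ∈ (Finset.range n).erase t, (Polynomial.X - Polynomial.C (c r))
  have hp : Polynomial.aeval x p = p.eval (c t) • u t := by
    rw [← mul_one (Polynomial.aeval x p), ← hu, Finset.mul_sum, Finset.sum_eq_single t]
    · exact aeval_mul_of_mul_eq_smul (hx t ht) p
    · intro r hr hrt
      have h0 : p.eval (c r) = 0 := by
        rw [Polynomial.eval_prod]
        exact Finset.prod_eq_zero (Finset.mem_erase.mpr ⟨hrt, hr⟩) (by simp)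
      rw [aeval_mul_of_mul_eq_smul (hx r (Finset.mem_range.mp hr)) p, h0, zero_smul]
    · intro h
      exact absurd (Finset.mem_range.mpr ht) h
  have hne : p.eval (c t) ≠ 0 := by
    rw [Polynomial.eval_prod, Finset.prod_ne_zero_iff]
    intro r hr
    rw [Polynomial.eval_sub, Polynomial.eval_X, Polynomial.eval_C, sub_ne_zero]
    exact fun h => (Finset.mem_erase.mp hr).1 (hc h).symm
  rw [← inv_smul_smul₀ hne (u t), ← hp]
  exact S.smul_mem (Algebra.adjoin_le (Set.singleton_subset_iff.mpr hS)
    (Polynomial.aeval_mem_adjoin_singleton R x)) _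

theorem k_mul_oneElt {t : ℕ} (ht : t ≤ d) :
    k d * oneElt d t = v ^ (2 * (t : ℤ) - (d : ℤ)) • oneElt d t := by
  rw [k, Finset.sum_mul, Finset.sum_eq_single t]
  · rw [smul_mul_assoc, (rep_oneElt ht).mul_oneElt ht, if_pos rfl]
  · intro r hr hrt
    rw [smul_mul_assoc, (rep_oneElt (Nat.lt_succ_iff.mp (Finset.mem_range.mp hr))).mul_oneElt ht,
      if_neg hrt, smul_zero]
  · intro h
    exact absurd (Finset.mem_range.mpr (Nat.lt_succ_iff.mpr ht)) h

theorem e_mul_oneElt {t : ℕ} (ht : t < d) : e d * oneElt d t = v ^ (-(t : ℤ)) • eElt d t := by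
  rw [e, Finset.sum_mul, Finset.sum_eq_single t]
  · rw [smul_mul_assoc, (rep_eElt ht).mul_oneElt ht.le, if_pos rfl]
  · intro r hr hrt
    rw [smul_mul_assoc, (rep_eElt (Finset.mem_range.mp hr)).mul_oneElt ht.le, if_neg hrt, smul_zero]
  · intro h
    exact absurd (Finset.mem_range.mpr ht) h

/-- The second subspace of `f_t` has dimension `t + 1`, so the idempotent that isolates it is
`1_{t+1}`. -/
theorem f_mul_oneElt {t : ℕ} (ht : t < d) :
    f d * oneElt d (t + 1) = v ^ (1 + (t : ℤ) - (d : ℤ)) • fElt d t := by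
  rw [f, Finset.sum_mul, Finset.sum_eq_single t]
  · rw [smul_mul_assoc, (rep_fElt ht).mul_oneElt ht, if_pos rfl]
  · intro r hr hrt
    rw [smul_mul_assoc, (rep_fElt (Finset.mem_range.mp hr)).mul_oneElt ht, if_neg (by omega),
      smul_zero]
  · intro h
    exact absurd (Finset.mem_range.mpr ht) h

theorem ell_mul_oneElt {t : ℕ} (h0 : 0 < t) (ht : t ≤ d) :
    ell d * oneElt d t = v ^ (-2 * (t : ℤ)) • (oneElt d t + xElt d t) := by
  rw [ell, add_mul, (rep_oneElt (Nat.zero_le d)).mul_oneElt ht, if_neg h0.ne, zero_add,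
    Finset.sum_mul, Finset.sum_eq_single t]
  · rw [smul_mul_assoc, add_mul, (rep_oneElt ht).mul_oneElt ht, (rep_xElt h0 ht).mul_oneElt ht,
      if_pos rfl, if_pos rfl]
  · intro r hr hrt
    obtain ⟨h1, h2⟩ := Finset.mem_Icc.mp hr
    rw [smul_mul_assoc, add_mul, (rep_oneElt h2).mul_oneElt ht, (rep_xElt h1 h2).mul_oneElt ht,
      if_neg hrt, if_neg hrt, add_zero, smul_zero]
  · intro h
    exact absurd (Finset.mem_Icc.mpr ⟨h0, ht⟩) h

variable {S : Subalgebra (RatFunc ℂ) (MUv 2 d)}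

theorem oneElt_mem (hk : k d ∈ S) {t : ℕ} (ht : t ≤ d) : oneElt d t ∈ S := by
  refine eigenprojection_mem (n := d + 1) (c := fun r : ℕ => v ^ (2 * (r : ℤ) - (d : ℤ))) sum_oneElt
    (fun r hr => k_mul_oneElt (Nat.lt_succ_iff.mp hr)) (fun r s h => ?_) hk
    (Nat.lt_succ_iff.mpr ht)
  have := v_zpow_injective h
  omega

theorem mem_of_zpow_smul_mem {x : MUv 2 d} {m : ℤ} (h : v ^ m • x ∈ S) : x ∈ S := by
  rw [← inv_smul_smul₀ (zpow_ne_zero m v_ne_zero) x]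
  exact S.smul_mem h _

/-- Right multiplication by `1_t` isolates one summand up to a power of `𝐯`, which is invertible.
Indices outside the ranges of the sums give zero functions. -/
theorem containsChevalley (he : e d ∈ S) (hf : f d ∈ S) (hk : k d ∈ S) (hl : ell d ∈ S) :
    ContainsChevalley S where
  one r := by
    by_cases hr : r ≤ d
    · exact (rep_oneElt hr).gen (oneElt_mem hk hr)
    · convert! Gen.zero using 1
      funext q
      exact (zeroFun_eq_infFun r r r).trans (infFun_eq_zero _ (by omega))
  x r := by
    by_cases hr : r ≤ d
    -- The zero subspace has no nonzero vector, so the function is zero for `r = 0`.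
    · rcases Nat.eq_zero_or_pos r with rfl | h0
      · convert! Gen.zero using 1
        funext q
        exact infFun_ne_zero_of_eq_zero 0 0
      · refine (rep_xElt h0 hr).gen ?_
        have h1 := S.mul_mem hl (oneElt_mem hk hr)
        rw [ell_mul_oneElt h0 hr] at h1
        have h2 := S.sub_mem (mem_of_zpow_smul_mem h1) (oneElt_mem hk hr)
        rwa [add_sub_cancel_left] at h2
    · convert! Gen.zero using 1
      funext q
      exact infFun_eq_zero _ (by omega)
  e r := by
    by_cases hr : r < d
    · have h1 := S.mul_mem he (oneElt_mem hk hr.le)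
      rw [e_mul_oneElt hr] at h1
      exact (rep_eElt hr).gen (mem_of_zpow_smul_mem h1)
    · convert! Gen.zero using 1
      funext q
      exact (zeroFun_eq_infFun (r + 1) r r).trans (infFun_eq_zero _ (by omega))
  f r := by
    by_cases hr : r < d
    · have h1 := S.mul_mem hf (oneElt_mem hk (t := r + 1) hr)
      rw [f_mul_oneElt hr] at h1
      exact (rep_fElt hr).gen (mem_of_zpow_smul_mem h1)
    · convert! Gen.zero using 1
      funext q
      exact (zeroFun_eq_infFun r (r + 1) r).trans (infFun_eq_zero _ (by omega))

end Generators

end Mirabolic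

end

/-- The elements `e, f, k, k⁻¹, ℓ` generate the `ℂ(𝐯)`-algebra `MU_𝐯(2, d)`. -/
theorem mainTheorem4 (d : ℕ) (hd : 0 < d) :
    Algebra.adjoin (RatFunc ℂ)
      ({Mirabolic.e d, Mirabolic.f d, Mirabolic.k d, Mirabolic.kInv d, Mirabolic.ell d} :
        Set (Mirabolic.MUv 2 d)) = ⊤ := by
  apply Mirabolic.ContainsChevalley.eq_top
  apply Mirabolic.containsChevalley <;> exact Algebra.subset_adjoin (by simp)
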